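/- Let $n\ge 1$ and let $x_1,\dots,x_n$ be commuting indeterminates. A word is a sequence $u=u_1\cdots u_n$ of positive integers, with positions ("sites") $1,\dots,n$ arranged cyclically. A queue is a subset $q\subseteq[n]$. It acts on words: $v=q(u)$ is computed by choosing an ordering $i_1,\dots,i_n$ of the sites with $u_{i_1}\le\dots\le u_{i_n}$ (the choice does not affect the result). Then for $i=i_n,i_{n-1},\dots,i_{|q|+1}$ (Phase I) set $v_j=u_i+1$, where $j$ is the first site weakly to the left (cyclically) of $i$ with $j\notin q$ and $v_j$ not yet set. After that, for $i=i_1,\dots,i_{|q|}$ (Phase II), set $v_j=u_i$, where $j$ is the first site weakly to the right (cyclically) of $i$ with $j\in q$ and $v_j$ not yet set. For a word $u$ regarded as a word with $\ell$ classes (all letters are $\le\ell$), let $m_k$ be the number of occurrences of $k$ in $u$. Let $\mathcal M_\ell(u)$ be the set of (ordinary) multiline queues $(q_1,\dots,q_{\ell-1})$ with $|q_i|=m_1+\dots+m_i$ for all $i$ and $q_{\ell-1}(\cdots q_1(1^n)\cdots)=u$, where $1^n=1\cdots1$. The spectral weight is $$\langle u\rangle=\sum_{(q_1,\dots,q_{\ell-1})\in\mathcal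 M_\ell(u)}\ \prod_{i=1}^{\ell-1}\ \prod_{j\in q_i}x_j\in\mathbb Z[x_1,\dots,x_n].$$ For $k\ge1$, let $\vee_k u$ be the word obtained from $u$ by replacing each letter $j>k$ by $j-1$; for $T=\{t_1<\dots<t_p\}$ let $\vee_T u=\vee_{t_1}\cdots\vee_{t_p}u$. A set of integers is lacunar if it contains no two consecutive integers. Fix $B=\{b_1<\dots<b_r\}\subseteq[n]$. Identify $\tau\in S_r$ with the word, regarded as a word with $r+1$ classes, whose letter at the site $b_j$ is $\tau(j)$ for $j\in[r]$ and whose letters at all the other sites are $r+1$. Let $w_0\in S_r$ be the permutation $r\,(r-1)\cdots1$, let $s_i$ be the simple transpositions, and for lacunar $S\subseteq[r-1]$ put $\sigma_S=\bigl(\prod_{i\in S}s_i\bigr)w_0$ and $$\psi(S)=\sum_{R\subseteq S}\langle\sigma_R\rangle .$$ Write $e_k$ and $h_k$ for the elementary and the complete homogeneous symmetric polynomials, with $h_k=0$ for $k<0$. **Corollary.** Let $T\subseteq[r-1]$ be lacunar. Then, with $\bigvee_Tw_0$ regarded as a word with $r+1-|T|$ classes, $$\psi(T)=\Bigl(\prod_{t\in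 T}e_t(x_1,\dots,x_n)\Bigr)\Bigl\langle\bigvee\nolimits_Tw_0\Bigr\rangle$$ and $$\psi(T)=\Bigl(\prod_{b\in B}x_b\Bigr)\Bigl(\prod_{t\in T}e_t(x_1,\dots,x_n)\Bigr)\det\bigl(h_{\gamma_j^T+i-j-1}(x_1,\dots,x_{b_j})\bigr)_{i,j\in[r]},\qquad \gamma_j^T=j-\#\{t\in T:\ t>r-j\}.$$ Moreover $$\langle\sigma_T\rangle=\sum_{S\subseteq T}(-1)^{|T|-|S|}\psi(S).$$ At $x_1=\dots=x_n=1$ the value of $\langle\sigma_T\rangle$ is the number of multiline queues in $\mathcal M_{r+1}(\sigma_T)$, and this value is $$\langle\sigma_T\rangle\big|_{x_1=\dots=x_n=1}=\sum_{S\subseteq T}(-1)^{|T|-|S|}\Bigl(\prod_{t\in S}\binom nt\Bigr)\det\Bigl(h_{\gamma_j^S+i-j-1}(\underbrace{1,\dots,1}_{b_j})\Bigr)_{i,j\in[r]},$$ where $h_k(\underbrace{1,\dots,1}_{b})=\binom{b+k-1}{k}$ for $k\ge0$ and $0$ for $k<0$. -/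

import Mathlib

open scoped BigOperators

noncomputable section

namespace MLQ

/-! ### Words, types and merging

The sites `1, ..., n` are the elements of `Fin n` (the site `i` is the element with value `i - 1`);
addition in `Fin n` is the cyclic structure of `ℤ / nℤ`.  A word is a function on the sites;
letters are the positive integers. -/

/-- Words of length `n` (the letters of the words that are considered are all at least `1`). -/
abbrev Word (n : ℕ) : Type := Fin n → ℕ

/-- The number `m_k` of occurrences of the letter `k` in `u`; `(m_1, m_2, ...)` is the type. -/
def typeOf {n : ℕ} (u : Word n) (k : ℕ) : ℕ := (Finset.univ.filter fun i => u i = k).card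

/-- The partial sum `p_k = m_1 + ... + m_k` of a type. -/
def partialSum (m : ℕ → ℕ) (k : ℕ) : ℕ := ∑ i ∈ Finset.Icc 1 k, m i

/-- The word `1^n`. -/
def oneWord (n : ℕ) : Word n := fun _ => 1

/-- Merging the classes `k` and `k + 1`: every letter `j > k` is replaced by `j - 1`. -/
def merge {n : ℕ} (k : ℕ) (u : Word n) : Word n := fun i => if k < u i then u i - 1 else u i

/-- For `T = {t_1 < ... < t_k}` this is `merge t_1 (... (merge t_k u))`. -/
def mergeSet {n : ℕ} (T : Finset ℕ) (u : Word n) : Word n :=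
  (T.sort (· ≤ ·)).foldr merge u

/-! ### Queues as functions on words -/

/-- One step of the algorithm: in the first site `j` in the list `sites` such that `j` lies in `s`
and the letter `v j` is not yet set, set the letter to `a`. -/
def place {n : ℕ} (s : Finset (Fin n)) (sites : List (Fin n)) (a : ℕ) (v : Fin n → Option ℕ) :
    Fin n → Option ℕ :=
  match sites.find? fun j => decide (j ∈ s ∧ v j = none) with
  | some j => Function.update v j (some a)
  | none => v

/-- The sites `i, i + 1, ...` weakly to the right of `i`, cyclically. -/
def sitesRight {n : ℕ} [NeZero n] (i : Fin n) : List (Fin n) :=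
  (List.finRange n).map fun k => i + k

/-- The sites `i, i - 1, ...` weakly to the left of `i`, cyclically. -/
def sitesLeft {n : ℕ} [NeZero n] (i : Fin n) : List (Fin n) :=
  (List.finRange n).map fun k => i - k

/-- The algorithm that computes `q(u)`, run with a list `order` of all the sites along which the
letters of `u` weakly increase.  Phase I goes through all the sites but the first `|q|` ones, from
the last one downwards; phase II goes through the first `|q|` ones. -/
def queueRun {n : ℕ} [NeZero n] (q : Finset (Fin n)) (u : Word n) (order : List (Fin n)) :
    Fin n → Option ℕ :=
  let v₁ := (order.drop q.card).reverse.foldl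
    (fun v i => place qᶜ (sitesLeft i) (u i + 1) v) (fun _ => none)
  (order.take q.card).foldl (fun v i => place q (sitesRight i) (u i) v) v₁

/-- The word `q(u)`.  The sites are ordered by their letters (ties are broken by position);
every letter has been set when the algorithm ends. -/
def queueAct {n : ℕ} [NeZero n] (q : Finset (Fin n)) (u : Word n) : Word n :=
  fun j => (queueRun q u ((List.finRange n).map (Tuple.sort u)) j).getD 0

/-! ### Multiline queues and the spectral weight -/

/-- `𝐪(1^n) = q_k(⋯ q_2(q_1(1^n)) ⋯)` for `𝐪 = (q_1, ..., q_k)`. -/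
def mlqWord {n k : ℕ} [NeZero n] (Q : Fin k → Finset (Fin n)) : Word n :=
  (List.ofFn Q).foldl (fun u q => queueAct q u) (oneWord n)

open Classical in
/-- For a word `u` regarded as a word with `ℓ` classes: the set of ordinary multiline queues
`𝐪 = (q_1, ..., q_{ℓ-1})` whose type is the type `(m_1, ..., m_ℓ)` of `u`
(that is, `|q_i| = m_1 + ... + m_i`) and which satisfy `𝐪(1^n) = u`. -/
def mlqs {n : ℕ} [NeZero n] (ℓ : ℕ) (u : Word n) : Finset (Fin (ℓ - 1) → Finset (Fin n)) :=
  Finset.univ.filter fun Q =>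
    (∀ i, (Q i).card = partialSum (typeOf u) (i.val + 1)) ∧ mlqWord Q = u

/-- The weight `∏ x_j` over all `i` and all `j ∈ q_i`. -/
def mlqWeight {n k : ℕ} (Q : Fin k → Finset (Fin n)) : MvPolynomial (Fin n) ℤ :=
  ∏ i, ∏ j ∈ Q i, MvPolynomial.X j

/-- The spectral weight `⟨u⟩` of a word `u` regarded as a word with `ℓ` classes. -/
def spectralWeight {n : ℕ} [NeZero n] (ℓ : ℕ) (u : Word n) : MvPolynomial (Fin n) ℤ :=
  ∑ Q ∈ mlqs ℓ u, mlqWeight Q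

/-! ### Permutations and the words attached to them -/

/-- A set of integers without two consecutive elements. -/
def IsLacunar (S : Finset ℕ) : Prop := ∀ i ∈ S, i + 1 ∉ S

/-- The simple transposition `s_i` of `i` and `i + 1` in the symmetric group on `{1, ..., r}`,
for `1 ≤ i ≤ r - 1`; the element `j` of `{1, ..., r}` is the element of `Fin r` with
value `j - 1`. -/
def simpleTransposition (r i : ℕ) : Equiv.Perm (Fin r) :=
  if h : 1 ≤ i ∧ i < r then Equiv.swap ⟨i - 1, by omega⟩ ⟨i, h.2⟩ else 1

/-- The longest element, with one-line notation `r (r-1) ⋯ 2 1`. -/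
def longest (r : ℕ) : Equiv.Perm (Fin r) := Fin.revPerm

/-- `σ_S = (∏_{i ∈ S} s_i) w_0`; the factors commute when `S` is lacunar. -/
def sigma (r : ℕ) (S : Finset ℕ) : Equiv.Perm (Fin r) :=
  ((S.sort (· ≤ ·)).map (simpleTransposition r)).prod * longest r

/-- For `B = {b_1 < ... < b_r}`, the word whose letter at the site `b_j` is `τ(j)`, and whose
letters at all the sites outside of `B` are `r + 1`.  It is regarded as a word with
`r + 1` classes. -/
def permWord {n r : ℕ} (B : Finset (Fin n)) (hB : B.card = r) (τ : Equiv.Perm (Fin r)) : Word n :=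
  Function.extend (B.orderEmbOfFin hB) (fun j => (τ j).val + 1) (fun _ => r + 1)

/-- `ψ(T) = ∑_{S ⊆ T} ⟨σ_S⟩`. -/
def psi {n r : ℕ} [NeZero n] (B : Finset (Fin n)) (hB : B.card = r) (T : Finset ℕ) :
    MvPolynomial (Fin n) ℤ :=
  ∑ S ∈ T.powerset, spectralWeight (r + 1) (permWord B hB (sigma r S))

/-! ### The determinant -/

/-- The complete homogeneous symmetric polynomial `h_k(x_1, ..., x_b)`, zero for `k < 0`. -/
def hPoly {n : ℕ} (b : Fin n) (k : ℤ) : MvPolynomial (Fin n) ℤ :=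
  if 0 ≤ k then
    MvPolynomial.rename Subtype.val (MvPolynomial.hsymm {i : Fin n // i ≤ b} ℤ k.toNat)
  else 0

/-- `γ_j = j - |{t ∈ T | t > r - j}|`, for `1 ≤ j ≤ r`. -/
def gam (r : ℕ) (T : Finset ℕ) (j : ℕ) : ℤ :=
  (j : ℤ) - ((T.filter fun t => r < t + j).card : ℤ)

/-- The number `γ_j + i - j - 1` for the row `i` and the column `j` of an `r × r` matrix
(the rows and columns `1, ..., r` are the elements of `Fin r` with values `0, ..., r - 1`). -/
def hIndex {r : ℕ} (T : Finset ℕ) (i j : Fin r) : ℤ :=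
  gam r T (j.val + 1) + ((i.val + 1 : ℕ) : ℤ) - ((j.val + 1 : ℕ) : ℤ) - 1

/-- The matrix `(h_{γ_j + i - j - 1}(x_1, ..., x_{b_j}))_{i, j}`. -/
def hMatrix {n r : ℕ} (B : Finset (Fin n)) (hB : B.card = r) (T : Finset ℕ) :
    Matrix (Fin r) (Fin r) (MvPolynomial (Fin n) ℤ) :=
  Matrix.of fun i j => hPoly (B.orderEmbOfFin hB j) (hIndex T i j)

/-- The value of `h_k` at `b` ones, for an integer `k`: it is `binom(b + k - 1, k)` for `k ≥ 0`,
the number of multisets of size `k` on `b` elements, and zero for `k < 0`. -/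
def hOnes (b : ℕ) (k : ℤ) : ℤ := if 0 ≤ k then (Nat.multichoose b k.toNat : ℤ) else 0

/-- The integer matrix with the entry `h_{γ_j + i - j - 1}(1, ..., 1)`, with `b_j` ones, in
row `i` and column `j`. -/
def onesMatrix {n r : ℕ} (B : Finset (Fin n)) (hB : B.card = r) (T : Finset ℕ) :
    Matrix (Fin r) (Fin r) ℤ :=
  Matrix.of fun i j => hOnes ((B.orderEmbOfFin hB j).val + 1) (hIndex T i j)

end MLQ

end

open scoped BigOperators

noncomputable section

set_option linter.unusedSectionVars false

namespace MLQ

/-! A word is encoded by the chain of its level sets `{i | u i ≤ k}`, and a queue acts on each level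
set separately: `step q U` is the departure set of a queue with arrivals `U` and services `q`. In
terms of counting functions on `ℤ`, departures are the minimum over `s ≤ t` of `U(s) + q(t) - q(s)`
(`isDeparture_step`), and the letter-by-letter algorithm agrees with this description
(`lev_queueAct`). A spectral weight thus becomes a weighted sum over sequences of queues with
prescribed sizes, with an indicator on the resulting chain (`spectralWeight_eq_chainSum`).

The elementary symmetric factors come from interchanging queues. If `|p| ≤ |q|`, replacing "`p`,
then `q`" by "`swapQueue p q`, then `step q p`" is a Pitman transform: it keeps the joint action
(`step_step_swapQueue`) and the product of the weights (`prod_swapQueue`), and it is injective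
(`swapQueue_injective`). A queue whose own level set is not observed and which is at least as large
as all queues below it can therefore be moved to the bottom, where it acts on empty sets and its sum
is `e_k`. Forgetting the level sets with sizes in `T` thus costs the factor `∏ e_t`
(`chainSum_forget`). For lacunar `T` the chains that agree with that of `w₀` outside `T` have
exactly two choices at each `t ∈ T`, and the words of `σ_S`, `S ⊆ T`, realize every combination once
(`sum_indicator_sigma`). Since merging at `T` deletes precisely these level sets, the first formula
follows (`psi_eq_mul_spectralWeight`).

For the determinant, the level sets of the word of `w₀` are the sets of largest elements of `B`, so
the last queue must be `B`. The queue below it has size `m`, the largest size less than `r` outside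
`T`, and the level sets before `B` acts are the sets of largest elements of some `C` with `|C| = m`
interlacing with `B`; this is a recursion in `r` (`topSum_recursion`). The determinant obeys the
same recursion, because differences of neighbouring columns expand by `h_k(x_1..x_b) -
h_k(x_1..x_b') = ∑ x_a h_{k-1}(x_1..x_a)`, the sum being over `b' < a ≤ b`
(`det_colMatrix_of_notMem`, `det_colMatrix_of_mem`). Inclusion-exclusion over subsets of `T` and
evaluation at ones give the remaining claims. -/

/-! ### Counting functions on the universal cover of the cycle -/

/-- The site of `Fin n` below the integer `t`. -/
def site (n : ℕ) [NeZero n] (t : ℤ) : Fin n :=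
  ⟨(t % n).toNat, by
    have hn : (0 : ℤ) < n := by exact_mod_cast Nat.pos_of_ne_zero (NeZero.ne n)
    have h1 := Int.emod_nonneg t hn.ne'
    have h2 := Int.emod_lt_of_pos t hn
    omega⟩

/-- A function on `ℤ` that increases by one exactly at the integers above an element of `q`. -/
def cnt {n : ℕ} (q : Finset (Fin n)) (t : ℤ) : ℤ := ∑ j ∈ q, (t - j.val) / (n : ℤ)

section cnt

variable {n : ℕ} [NeZero n]

lemma natCast_pos_of_neZero : (0 : ℤ) < n := by
  exact_mod_cast Nat.pos_of_ne_zero (NeZero.ne n)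

lemma site_val (t : ℤ) : (((site n t).val : ℕ) : ℤ) = t % n := by
  have h1 := Int.emod_nonneg t (natCast_pos_of_neZero (n := n)).ne'
  simp [site, h1]

lemma site_coe (j : Fin n) : site n (j.val : ℤ) = j := by
  apply Fin.ext
  have h := site_val (n := n) (j.val : ℤ)
  rw [Int.emod_eq_of_lt (by positivity) (by exact_mod_cast j.2)] at h
  exact_mod_cast h

lemma site_eq_iff {s t : ℤ} : site n s = site n t ↔ s % n = t % n := by
  rw [← site_val, ← site_val, Fin.ext_iff]
  norm_cast

lemma site_add_period (t : ℤ) : site n (t + n) = site n t := by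
  rw [site_eq_iff]; simp

lemma site_eq_coe_iff (t : ℤ) (j : Fin n) : site n t = j ↔ (n : ℤ) ∣ t - j.val := by
  conv_lhs => rw [← site_coe j]
  rw [site_eq_iff]
  exact ⟨fun h => Int.ModEq.dvd (Int.ModEq.symm h), fun h => ((Int.modEq_iff_dvd).2 h).symm⟩

lemma ediv_sub_ediv_pred (t : ℤ) :
    t / (n : ℤ) - (t - 1) / (n : ℤ) = if (n : ℤ) ∣ t then 1 else 0 := by
  have hn := natCast_pos_of_neZero (n := n)
  split_ifs with h
  · obtain ⟨k, rfl⟩ := h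
    rw [Int.mul_ediv_cancel_left _ hn.ne']
    have : ((n : ℤ) * k - 1) / n = k - 1 := by
      rw [Int.ediv_eq_iff_of_pos hn]
      constructor <;> nlinarith
    omega
  · have h0 : t % n ≠ 0 := fun h' => h (Int.dvd_of_emod_eq_zero h')
    have h1 := Int.emod_nonneg t hn.ne'
    have h2 := Int.emod_lt_of_pos t hn
    have h3 := Int.emod_add_mul_ediv t n
    have : (t - 1) / n = t / n := by
      rw [Int.ediv_eq_iff_of_pos hn]
      constructor
      · have : 0 < t % n := lt_of_le_of_ne h1 (Ne.symm h0)
        nlinarith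
      · nlinarith
    omega

lemma cnt_sub_pred (q : Finset (Fin n)) (t : ℤ) :
    cnt q t - cnt q (t - 1) = if site n t ∈ q then 1 else 0 := by
  unfold cnt
  rw [← Finset.sum_sub_distrib]
  have : ∀ j ∈ q, (t - (j.val : ℤ)) / (n : ℤ) - (t - 1 - (j.val : ℤ)) / (n : ℤ) =
      if site n t = j then 1 else 0 := by
    intro j _
    have := ediv_sub_ediv_pred (n := n) (t - j.val)
    rw [show t - 1 - (j.val : ℤ) = t - j.val - 1 by ring, this]
    simp only [site_eq_coe_iff]
  rw [Finset.sum_congr rfl this]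
  simp

lemma cnt_sub_pred_of_mem {q : Finset (Fin n)} {t : ℤ} (h : site n t ∈ q) :
    cnt q t - cnt q (t - 1) = 1 := by rw [cnt_sub_pred, if_pos h]

lemma cnt_add_period (q : Finset (Fin n)) (t : ℤ) : cnt q (t + n) = cnt q t + q.card := by
  have hn := natCast_pos_of_neZero (n := n)
  unfold cnt
  have : ∀ j ∈ q, (t + n - (j.val : ℤ)) / (n : ℤ) = (t - j.val) / (n : ℤ) + 1 := by
    intro j _
    rw [show t + n - (j.val : ℤ) = (t - j.val) + n by ring,
      Int.add_ediv_of_dvd_right (dvd_refl _), Int.ediv_self hn.ne']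
  rw [Finset.sum_congr rfl this, Finset.sum_add_distrib]
  simp

lemma cnt_sub_period (q : Finset (Fin n)) (t : ℤ) : cnt q (t - n) = cnt q t - q.card := by
  have := cnt_add_period q (t - n)
  rw [sub_add_cancel] at this
  omega

lemma cnt_sub_eq_card (q : Finset (Fin n)) {s t : ℤ} (h : s ≤ t) :
    cnt q t - cnt q s = (((Finset.Ioc s t).filter fun x => site n x ∈ q).card : ℤ) := by
  induction t, h using Int.leInduction with
  | base => simp
  | succ t h ih =>
    have h1 := cnt_sub_pred q (t + 1)
    have h2 : Finset.Ioc s (t + 1) = insert (t + 1) (Finset.Ioc s t) := by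
      ext x; simp only [Finset.mem_Ioc, Finset.mem_insert]; omega
    rw [add_sub_cancel_right] at h1
    rw [h2, Finset.filter_insert]
    split_ifs at h1 ⊢ with h3
    · rw [Finset.card_insert_of_notMem (by simp)]
      push_cast; omega
    · omega

lemma cnt_mono (q : Finset (Fin n)) : Monotone (cnt q) := by
  intro s t h
  have := cnt_sub_eq_card q h
  omega

lemma cnt_sub_le_of_subset {p q : Finset (Fin n)} (hpq : p ⊆ q) {s t : ℤ} (h : s ≤ t) :
    cnt p t - cnt p s ≤ cnt q t - cnt q s := by
  rw [cnt_sub_eq_card p h, cnt_sub_eq_card q h]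
  exact_mod_cast Finset.card_le_card (fun x hx => by
    simp only [Finset.mem_filter] at hx ⊢
    exact ⟨hx.1, hpq hx.2⟩)

/-- This fixes the normalization: in this window every quotient in `cnt` is `0` or `-1`, so all
counting functions vanish at `n - 1` and can be compared there without constants. -/
lemma cnt_eq_neg_card (q : Finset (Fin n)) {t : ℤ} (h0 : -1 ≤ t) (h1 : t < n) :
    cnt q t = -((q.filter fun j => t < (j.val : ℤ)).card : ℤ) := by
  have hn := natCast_pos_of_neZero (n := n)
  unfold cnt
  have : ∀ j ∈ q, (t - (j.val : ℤ)) / (n : ℤ) = if t < (j.val : ℤ) then -1 else 0 := by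
    intro j _
    have hj : (j.val : ℤ) < n := by exact_mod_cast j.2
    split_ifs with h
    · rw [Int.ediv_eq_iff_of_pos hn]; constructor <;> linarith
    · exact Int.ediv_eq_zero_of_lt (by omega) (by omega)
  rw [Finset.sum_congr rfl this, ← Finset.sum_filter]
  simp

/-- A set is determined by its counting function up to a constant. -/
lemma eq_of_cnt_eq_add {p q : Finset (Fin n)} (c : ℤ) (h : ∀ t, cnt p t = cnt q t + c) :
    p = q := by
  ext j
  have h1 := cnt_sub_pred p j.val
  have h2 := cnt_sub_pred q j.val
  rw [h, h, site_coe] at h1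
  rw [site_coe] at h2
  split_ifs at h1 h2 <;> first | omega | simp_all

end cnt

/-! ### Tandem queues and the Pitman transform -/

/-- `a'` counts the departures from a queue with the arrivals `a` and the services `q`. -/
def IsDeparture (a q a' : ℤ → ℤ) : Prop :=
  ∀ t, IsLeast {x | ∃ s ≤ t, x = a s + (q t - q s)} (a' t)

/-- Needed because the departure function agrees with the counting function of `step` only up to a
constant. -/
lemma IsDeparture.sub_const {a q a' : ℤ → ℤ} (h : IsDeparture a q a') (c : ℤ) :
    IsDeparture (fun t => a t + c) q (fun t => a' t + c) := by
  intro t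
  obtain ⟨⟨s, hs, h1⟩, h2⟩ := h t
  refine ⟨⟨s, hs, by simp only; omega⟩, ?_⟩
  rintro _ ⟨s', hs', rfl⟩
  have := h2 ⟨s', hs', rfl⟩
  simp only; omega

section Pitman

variable {f g f' g' : ℤ → ℤ}

/-- The running minimum `f' - g` of `f - g`. -/
lemma IsDeparture.isLeast_sub (h : IsDeparture f g f') (t : ℤ) :
    IsLeast {x | ∃ s ≤ t, x = f s - g s} (f' t - g t) := by
  obtain ⟨⟨s, hs, h1⟩, h2⟩ := h t
  refine ⟨⟨s, hs, by omega⟩, ?_⟩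
  rintro _ ⟨s', hs', rfl⟩
  have := h2 ⟨s', hs', rfl⟩
  omega

lemma running_le {h m : ℤ → ℤ} (hm : ∀ t, IsLeast {x | ∃ s ≤ t, x = h s} (m t)) {s t : ℤ}
    (hst : s ≤ t) : m t ≤ h s := (hm t).2 ⟨s, hst, rfl⟩

lemma running_antitone {h m : ℤ → ℤ} (hm : ∀ t, IsLeast {x | ∃ s ≤ t, x = h s} (m t)) {s t : ℤ}
    (hst : s ≤ t) : m t ≤ m s := by
  obtain ⟨⟨r, hr, h1⟩, _⟩ := hm s
  rw [h1]
  exact running_le hm (hr.trans hst)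

/-- A function with steps at least `-1` hits its running minimum before it goes below it. -/
lemma exists_hit {h m : ℤ → ℤ} (hm : ∀ t, IsLeast {x | ∃ s ≤ t, x = h s} (m t))
    (hstep : ∀ t, h (t - 1) - 1 ≤ h t) {s t : ℤ} (hst : s ≤ t) (hle : h t ≤ m s) :
    ∃ r, s ≤ r ∧ r ≤ t ∧ h r = m s ∧ m r = m s := by
  -- The first time `r ≥ s` at which `h` is at most `m s`; as `h` drops by at most one, it equals `m
  -- s` there.
  obtain ⟨r, ⟨hr1, hr2⟩, hr3⟩ := Int.exists_least_of_bdd (P := fun r => s ≤ r ∧ h r ≤ m s)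
    ⟨s, fun z hz => hz.1⟩ ⟨t, hst, hle⟩
  have e : h r = m s := by
    rcases eq_or_lt_of_le hr1 with rfl | hlt
    · exact le_antisymm hr2 (running_le hm le_rfl)
    · by_contra hne
      have h1 := hstep r
      have h2 := hr3 (r - 1) ⟨by omega, by omega⟩
      omega
  refine ⟨r, hr1, hr3 t ⟨hst, hle⟩, e, le_antisymm (running_antitone hm hr1) ?_⟩
  obtain ⟨⟨z, hz, h1⟩, _⟩ := hm r
  rw [h1]
  by_cases hzs : z ≤ s
  · exact running_le hm hzs
  · by_contra hlt
    have := hr3 z ⟨by omega, by omega⟩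
    have : z = r := by omega
    subst this
    omega

/-- Interchanging two queues by the Pitman transform does not change the departures. -/
theorem IsDeparture.interchange {a a₁ a₂ b₁ b₂ : ℤ → ℤ} (hf : IsDeparture f g f')
    (hg : ∀ t, g' t = f t + g t - f' t)
    (hstep : ∀ t, f (t - 1) - g (t - 1) - 1 ≤ f t - g t)
    (h₁ : IsDeparture a f a₁) (h₂ : IsDeparture a₁ g a₂)
    (k₁ : IsDeparture a g' b₁) (k₂ : IsDeparture b₁ f' b₂) (t : ℤ) : a₂ t = b₂ t := by
  set h : ℤ → ℤ := fun t => f t - g t with hh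
  set m : ℤ → ℤ := fun t => f' t - g t with hmdef
  have hm : ∀ t, IsLeast {x | ∃ s ≤ t, x = h s} (m t) := hf.isLeast_sub
  have hstep' : ∀ t, h (t - 1) - 1 ≤ h t := hstep
  apply le_antisymm
  · obtain ⟨⟨s'', hs'', e2⟩, -⟩ := k₂ t
    obtain ⟨⟨s, hs, e1⟩, -⟩ := k₁ s''
    -- After cancelling `a s - f s + g t`, the first order of the queues minimizes `h s'` and the
    -- second one `m t + m s + h s'' - 2 m s''`. If `m t = m s`, then `m` is constant on `[s, t]`
    -- and `s' = s''` works. Otherwise the minimum `m t` is attained after `s`, and it is small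
    -- enough because `m s ≥ m s''` and `h s'' ≥ m s''`.
    have key : ∃ s', s ≤ s' ∧ s' ≤ t ∧ h s' ≤ m t + m s + (h s'' - 2 * m s'') := by
      by_cases hmt : m t = m s
      · have i1 := running_antitone hm hs
        have i2 := running_antitone hm hs''
        exact ⟨s'', hs, hs'', by omega⟩
      · have i0 := running_antitone hm (hs.trans hs'')
        obtain ⟨⟨s', hs', e⟩, -⟩ := hm t
        refine ⟨s', ?_, hs', ?_⟩
        · by_contra hlt
          have := running_le hm (show s' ≤ s by omega)
          omega
        · have i1 := running_antitone hm hs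
          have i2 := running_le hm (le_refl s'')
          omega
    obtain ⟨s', h1, h2, h3⟩ := key
    have u1 := (h₂ t).2 ⟨s', h2, rfl⟩
    have u2 := (h₁ s').2 ⟨s, h1, rfl⟩
    have g1 := hg s''
    have g2 := hg s
    simp only [hh, hmdef] at h3
    omega
  · obtain ⟨⟨s', hs', e2⟩, -⟩ := h₂ t
    obtain ⟨⟨s, hs, e1⟩, -⟩ := h₁ s'
    -- In the nonconstant case `s''` is a point with `h s'' = m s'' = m s`, where the left-hand side
    -- collapses to `m t`.
    have key : ∃ s'', s ≤ s'' ∧ s'' ≤ t ∧ m t + m s + (h s'' - 2 * m s'') ≤ h s' := by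
      by_cases hmt : m t = m s
      · have i1 := running_antitone hm hs
        have i2 := running_antitone hm hs'
        exact ⟨s', hs, hs', by omega⟩
      · have i0 := running_antitone hm (hs.trans hs')
        obtain ⟨⟨z, hz, e⟩, -⟩ := hm t
        have hsz : s ≤ z := by
          by_contra hlt
          have := running_le hm (show z ≤ s by omega)
          omega
        obtain ⟨s'', h1, h2, h3, h4⟩ := exists_hit hm hstep' hsz (by omega)
        have := running_le hm hs'
        exact ⟨s'', h1, h2.trans hz, by omega⟩
    obtain ⟨s'', h1, h2, h3⟩ := key
    have u1 := (k₂ t).2 ⟨s'', h2, rfl⟩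
    have u2 := (k₁ s'').2 ⟨s, h1, rfl⟩
    have g1 := hg s''
    have g2 := hg s
    simp only [hh, hmdef] at h3
    omega

/-- The running minimum can be recovered from the transformed functions. -/
lemma IsDeparture.isLeast_neg (hf : IsDeparture f g f') (hg : ∀ t, g' t = f t + g t - f' t)
    (hstep : ∀ t, f (t - 1) - g (t - 1) - 1 ≤ f t - g t)
    (hrec : ∀ s t, ∃ r, t ≤ r ∧ f r - g r ≤ f s - g s) (t : ℤ) :
    IsLeast {x | ∃ s, t ≤ s ∧ x = g' s - f' s} (-(f' t - g t)) := by
  set h : ℤ → ℤ := fun t => f t - g t with hh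
  set m : ℤ → ℤ := fun t => f' t - g t with hmdef
  have hm : ∀ t, IsLeast {x | ∃ s ≤ t, x = h s} (m t) := hf.isLeast_sub
  constructor
  · obtain ⟨⟨s, hs, e⟩, -⟩ := hm t
    -- Here `g' - f' = h - 2m`, which is at least `-m` and equals `-m t` at a point after `t` where
    -- `h = m = m t`. Recurrence guarantees that `h` comes back to this level after `t`.
    obtain ⟨r, hr, hle⟩ := hrec s t
    obtain ⟨z, hz1, hz2, hz3, hz4⟩ := exists_hit hm hstep hr (by simp only [hh] at e ⊢; omega)
    refine ⟨z, hz1, ?_⟩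
    have := hg z
    simp only [hh, hmdef] at *
    omega
  · rintro _ ⟨s, hs, rfl⟩
    have i1 := running_le hm (le_refl s)
    have i2 := running_antitone hm hs
    have := hg s
    simp only [hh, hmdef] at *
    omega

end Pitman

/-! ### The action of a queue on sets of sites -/

open Classical in
/-- The set `{j | q(u)_j ≤ k}` for a queue `q` and the set `U = {i | u_i ≤ k}`. -/
def step {n : ℕ} (q U : Finset (Fin n)) : Finset (Fin n) :=
  q.filter fun j => ∃ s : ℤ, s < j.val ∧ cnt q j.val - cnt q s ≤ cnt U j.val - cnt U s

/-- The second component of the interchange of the queues `p` and `q`. -/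
def swapQueue {n : ℕ} (p q : Finset (Fin n)) : Finset (Fin n) := p ∪ (q \ step q p)

lemma mem_step {n : ℕ} {q U : Finset (Fin n)} {j : Fin n} : j ∈ step q U ↔
    j ∈ q ∧ ∃ s : ℤ, s < j.val ∧ cnt q j.val - cnt q s ≤ cnt U j.val - cnt U s := by
  simp [step]

lemma step_subset {n : ℕ} (q U : Finset (Fin n)) : step q U ⊆ q := fun _ hj => (mem_step.1 hj).1

section step

variable {n : ℕ} [NeZero n]

lemma cnt_add_mul (q : Finset (Fin n)) (t k : ℤ) : cnt q (t + n * k) = cnt q t + k * q.card := by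
  have hn := natCast_pos_of_neZero (n := n)
  unfold cnt
  have : ∀ j ∈ q, (t + n * k - (j.val : ℤ)) / (n : ℤ) = (t - j.val) / (n : ℤ) + k := by
    intro j _
    rw [show t + n * k - (j.val : ℤ) = (t - j.val) + n * k by ring,
      Int.add_mul_ediv_left _ _ hn.ne']
  rw [Finset.sum_congr rfl this, Finset.sum_add_distrib]
  simp [mul_comm]

lemma mem_step_site {q U : Finset (Fin n)} {t : ℤ} : site n t ∈ step q U ↔
    site n t ∈ q ∧ ∃ s < t, cnt q t - cnt q s ≤ cnt U t - cnt U s := by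
  rw [mem_step, site_val]
  have ht : t = t % n + n * (t / n) := (Int.emod_add_mul_ediv t n).symm
  refine and_congr_right fun _ => ⟨?_, ?_⟩
  · rintro ⟨s, hs, h⟩
    refine ⟨s + n * (t / n), by omega, ?_⟩
    have e1 := cnt_add_mul q (t % n) (t / n)
    have e2 := cnt_add_mul U (t % n) (t / n)
    rw [← ht] at e1 e2
    rw [cnt_add_mul, cnt_add_mul, e1, e2]
    linarith
  · rintro ⟨s, hs, h⟩
    refine ⟨s + n * (-(t / n)), by rw [mul_neg]; omega, ?_⟩
    have e1 := cnt_add_mul q (t % n) (t / n)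
    have e2 := cnt_add_mul U (t % n) (t / n)
    rw [← ht] at e1 e2
    rw [cnt_add_mul, cnt_add_mul]
    linarith

/-- With at least as many arrivals as services every service is used: a full turn of the cycle is
the witnessing window. -/
lemma step_eq_self {q U : Finset (Fin n)} (h : q.card ≤ U.card) : step q U = q := by
  refine Finset.Subset.antisymm (step_subset _ _) fun j hj => mem_step.2 ⟨hj, j.val - n, ?_, ?_⟩
  · have := natCast_pos_of_neZero (n := n); omega
  · rw [cnt_sub_period, cnt_sub_period]; omega

lemma step_mono (q : Finset (Fin n)) {U V : Finset (Fin n)} (h : U ⊆ V) :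
    step q U ⊆ step q V := by
  intro j hj
  obtain ⟨hq, s, hs, hle⟩ := mem_step.1 hj
  exact mem_step.2 ⟨hq, s, hs, hle.trans (cnt_sub_le_of_subset h hs.le)⟩

/-- An arrival at a service site makes that service used; the window consists of this one site. -/
lemma inter_subset_step (q U : Finset (Fin n)) : U ∩ q ⊆ step q U := by
  intro j hj
  rw [Finset.mem_inter] at hj
  refine mem_step.2 ⟨hj.2, j.val - 1, by omega, ?_⟩
  rw [cnt_sub_pred_of_mem (by rw [site_coe]; exact hj.2),
    cnt_sub_pred_of_mem (by rw [site_coe]; exact hj.1)]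

lemma step_empty (q : Finset (Fin n)) : step q ∅ = ∅ := by
  refine Finset.eq_empty_of_forall_notMem fun j hj => ?_
  obtain ⟨hq, s, hs, hle⟩ := mem_step.1 hj
  have h1 := cnt_sub_pred_of_mem (t := (j.val : ℤ)) (by rw [site_coe]; exact hq)
  have h2 := cnt_mono q (show s ≤ (j.val : ℤ) - 1 by omega)
  have h3 : ∀ t : ℤ, cnt (∅ : Finset (Fin n)) t = 0 := fun t => by simp [cnt]
  rw [h3, h3] at hle
  omega

/-- Over each period `cnt U - cnt q` changes by `|U| - |q| ≤ 0`, so it stays bounded below towards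
`-∞`. This makes the minimum over all `s ≤ t` exist. -/
lemma cnt_sub_cnt_bound {q U : Finset (Fin n)} (h : U.card ≤ q.card) {s t : ℤ} (hst : s ≤ t) :
    -(U.card : ℤ) + (t / n) * ((U.card : ℤ) - q.card) ≤ cnt U s - cnt q s := by
  have hn := natCast_pos_of_neZero (n := n)
  have h1 := Int.emod_nonneg s hn.ne'
  have h2 := Int.emod_lt_of_pos s hn
  have e1 := cnt_add_mul q (s % n) (s / n)
  have e2 := cnt_add_mul U (s % n) (s / n)
  rw [Int.emod_add_mul_ediv] at e1 e2
  have b1 := cnt_eq_neg_card q (by omega : -1 ≤ s % n) h2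
  have b2 := cnt_eq_neg_card U (by omega : -1 ≤ s % n) h2
  have c2 : ((U.filter fun j => s % n < (j.val : ℤ)).card : ℤ) ≤ U.card := by
    exact_mod_cast Finset.card_filter_le _ _
  have h4 : s / n ≤ t / n := Int.ediv_le_ediv hn hst
  have h5 : (U.card : ℤ) ≤ q.card := by exact_mod_cast h
  nlinarith

lemma exists_const_of_sub_pred {f g : ℤ → ℤ} (h : ∀ t, f t - f (t - 1) = g t - g (t - 1)) :
    ∃ c, ∀ t, f t = g t + c := by
  refine ⟨f 0 - g 0, fun t => ?_⟩
  induction t using Int.induction_on with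
  | zero => ring
  | succ i ih => have := h (i + 1); rw [add_sub_cancel_right] at this; linarith
  | pred i ih => have := h (-i); linarith

lemma exists_isDeparture {q U : Finset (Fin n)} (h : U.card ≤ q.card) :
    ∃ a', IsDeparture (cnt U) (cnt q) a' := by
  have : ∀ t, ∃ x, IsLeast {x | ∃ s ≤ t, x = cnt U s + (cnt q t - cnt q s)} x := by
    intro t
    obtain ⟨x, hx, hx'⟩ := Int.exists_least_of_bdd
      (P := fun x => ∃ s ≤ t, x = cnt U s + (cnt q t - cnt q s))
      ⟨cnt q t + (-(U.card : ℤ) + (t / n) * ((U.card : ℤ) - q.card)), by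
        rintro _ ⟨s, hs, rfl⟩
        have := cnt_sub_cnt_bound h hs
        linarith⟩ ⟨_, t, le_rfl, rfl⟩
    exact ⟨x, hx, fun y hy => hx' y hy⟩
  choose a' ha' using this
  exact ⟨a', ha'⟩

/-- The two functions have the same increments. The running minimum grows by one at `t` exactly when
`t` is a service site and the minimum at `t` is attained at some `s < t`, which is the condition
defining `step`; otherwise it does not grow. -/
lemma isDeparture_step {q U : Finset (Fin n)} (h : U.card ≤ q.card) :
    ∃ c, IsDeparture (cnt U) (cnt q) (fun t => cnt (step q U) t + c) := by
  obtain ⟨a', ha'⟩ := exists_isDeparture h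
  obtain ⟨c, hc⟩ := exists_const_of_sub_pred (f := a') (g := cnt (step q U)) (by
    intro t
    obtain ⟨⟨s, hs, e⟩, h1⟩ := ha' t
    obtain ⟨⟨s', hs', e'⟩, h1'⟩ := ha' (t - 1)
    have i1 := h1 ⟨t, le_rfl, rfl⟩
    have i2 := h1 ⟨s', by omega, rfl⟩
    have i3 := h1' ⟨t - 1, le_rfl, rfl⟩
    have m := cnt_mono U (show t - 1 ≤ t by omega)
    rw [cnt_sub_pred (step q U)]
    have hq := cnt_sub_pred q t
    split_ifs with hm
    · obtain ⟨hmq, r, hr, hle⟩ := mem_step_site.1 hm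
      rw [if_pos hmq] at hq
      have i4 := h1' ⟨r, by omega, rfl⟩
      rcases eq_or_lt_of_le hs with rfl | hlt
      · omega
      · have i5 := h1' ⟨s, by omega, rfl⟩
        omega
    · by_cases hmq : site n t ∈ q
      · rw [if_pos hmq] at hq
        have : ∀ r < t, cnt U t - cnt U r < cnt q t - cnt q r := by
          intro r hr
          by_contra hcon
          exact hm (mem_step_site.2 ⟨hmq, r, hr, by omega⟩)
        have j1 := this s' (by omega)
        rcases eq_or_lt_of_le hs with rfl | hlt
        · omega
        · have i5 := h1' ⟨s, by omega, rfl⟩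
          omega
      · rw [if_neg hmq] at hq
        rcases eq_or_lt_of_le hs with rfl | hlt
        · omega
        · have i5 := h1' ⟨s, by omega, rfl⟩
          omega)
  refine ⟨c, ?_⟩
  rw [show (fun t => cnt (step q U) t + c) = a' from (funext hc).symm]
  exact ha'

/-- Minimizers at `0` and at `n` are translates of each other by a period, so the departure function
increases by `|U|` per period. -/
lemma card_step {q U : Finset (Fin n)} (h : U.card ≤ q.card) : (step q U).card = U.card := by
  obtain ⟨c, hc⟩ := isDeparture_step h
  have e := cnt_add_period (step q U) 0
  have e' := cnt_add_period q 0
  obtain ⟨⟨s, hs, e1⟩, h1⟩ := hc 0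
  obtain ⟨⟨s', hs', e2⟩, h2⟩ := hc (0 + n)
  have i1 := h1 ⟨s' - n, by omega, rfl⟩
  have i2 := h2 ⟨s + n, by omega, rfl⟩
  rw [cnt_sub_period, cnt_sub_period] at i1
  have j1 := cnt_add_period U s
  have j2 := cnt_add_period q s
  simp only at *
  omega

variable {p q : Finset (Fin n)}

lemma disjoint_sdiff_step (p q : Finset (Fin n)) : Disjoint p (q \ step q p) := by
  rw [Finset.disjoint_left]
  intro x hx hx'
  rw [Finset.mem_sdiff] at hx'
  exact hx'.2 (inter_subset_step q p (Finset.mem_inter.2 ⟨hx, hx'.1⟩))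

/-- The interchange only redistributes the sites of `p` and `q`, with multiplicity. Hence counting
functions and total sizes are conserved; the multiplicative version below gives the conservation of
weights. -/
lemma sum_swapQueue {M : Type*} [AddCommMonoid M] (f : Fin n → M) :
    ∑ j ∈ swapQueue p q, f j + ∑ j ∈ step q p, f j = ∑ j ∈ p, f j + ∑ j ∈ q, f j := by
  rw [swapQueue, Finset.sum_union (disjoint_sdiff_step p q), add_assoc,
    Finset.sum_sdiff (step_subset q p)]

lemma prod_swapQueue {M : Type*} [CommMonoid M] (f : Fin n → M) :
    (∏ j ∈ swapQueue p q, f j) * ∏ j ∈ step q p, f j = (∏ j ∈ p, f j) * ∏ j ∈ q, f j := by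
  rw [swapQueue, Finset.prod_union (disjoint_sdiff_step p q), mul_assoc,
    Finset.prod_sdiff (step_subset q p)]

lemma cnt_swapQueue (t : ℤ) :
    cnt (swapQueue p q) t = cnt p t + cnt q t - cnt (step q p) t := by
  have := sum_swapQueue (p := p) (q := q) (fun j => (t - (j.val : ℤ)) / (n : ℤ))
  unfold cnt
  linarith

lemma card_swapQueue (h : p.card ≤ q.card) : (swapQueue p q).card = q.card := by
  have := sum_swapQueue (p := p) (q := q) (fun _ => 1)
  simp only [Finset.sum_const, smul_eq_mul, mul_one] at this
  rw [card_step h] at this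
  omega

lemma cnt_sub_cnt_step (p q : Finset (Fin n)) (t : ℤ) :
    cnt p (t - 1) - cnt q (t - 1) - 1 ≤ cnt p t - cnt q t := by
  have h1 := cnt_sub_pred p t
  have h2 := cnt_sub_pred q t
  split_ifs at h1 h2 <;> omega

/-- Two queues can be interchanged without changing their joint action. -/
theorem step_step_swapQueue (h : p.card ≤ q.card) (U : Finset (Fin n)) :
    step (step q p) (step (swapQueue p q) U) = step q (step p U) := by
  by_cases hU : U.card ≤ p.card
  · obtain ⟨c, hf⟩ := isDeparture_step h
    obtain ⟨c₁, h₁⟩ := isDeparture_step hU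
    obtain ⟨c₂, h₂⟩ := isDeparture_step (q := q) (U := step p U) (by rw [card_step hU]; omega)
    have hU' : U.card ≤ (swapQueue p q).card := by rw [card_swapQueue h]; omega
    obtain ⟨d₁, k₁⟩ := isDeparture_step hU'
    obtain ⟨d₂, k₂⟩ := isDeparture_step (q := step q p) (U := step (swapQueue p q) U)
      (by rw [card_step h, card_step hU']; exact hU)
    have h₂' := h₂.sub_const c₁
    have k₂' := k₂.sub_const d₁
    -- Services enter a departure function only through differences. The shift by `c` makes the
    -- relation `g' = f + g - f'` hold exactly, with `f' = cnt (step q p) + c`.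
    have hk₁ : IsDeparture (cnt U) (fun t => cnt (swapQueue p q) t - c)
        (fun t => cnt (step (swapQueue p q) U) t + d₁) := by
      intro t
      simpa using k₁ t
    have hk₂ : IsDeparture (fun t => cnt (step (swapQueue p q) U) t + d₁)
        (fun t => cnt (step q p) t + c)
        (fun t => cnt (step (step q p) (step (swapQueue p q) U)) t + d₂ + d₁) := by
      intro t
      simpa using k₂' t
    have key := IsDeparture.interchange hf (fun t => by rw [cnt_swapQueue]; ring)
      (cnt_sub_cnt_step p q) h₁ h₂' hk₁ hk₂
    exact eq_of_cnt_eq_add (c₂ + c₁ - d₂ - d₁) fun t => by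
      have := key t
      omega
  -- With more than `|p|` arrivals the queue `p` is saturated, and so is `step q p` in the other
  -- order; both sides are `step q p`.
  · rw [step_eq_self (q := p) (by omega)]
    refine step_eq_self ?_
    rw [card_step h]
    by_cases hU' : U.card ≤ (swapQueue p q).card
    · rw [card_step hU']; omega
    · rw [step_eq_self (by omega), card_swapQueue h]; exact h

/-- Moving to the right by whole periods does not increase `cnt p - cnt q`. -/
lemma cnt_recurrent (h : p.card ≤ q.card) (s t : ℤ) :
    ∃ r, t ≤ r ∧ cnt p r - cnt q r ≤ cnt p s - cnt q s := by
  have hn := natCast_pos_of_neZero (n := n)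
  refine ⟨s + n * |t - s|, ?_, ?_⟩
  · have := le_abs_self (t - s)
    have := abs_nonneg (t - s)
    nlinarith
  · rw [cnt_add_mul, cnt_add_mul]
    have := abs_nonneg (t - s)
    have h' : (p.card : ℤ) ≤ q.card := by exact_mod_cast h
    nlinarith

/-- The minimum of `g' - f'` over the future of `t` is minus the past minimum `f' t - g t`. So the
transformed pair determines `g`, that is `q`, and then `p` by conservation of the counting
functions. -/
theorem swapQueue_injective {p q p' q' : Finset (Fin n)} (h : p.card ≤ q.card)
    (h' : p'.card ≤ q'.card) (e₁ : swapQueue p q = swapQueue p' q')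
    (e₂ : step q p = step q' p') : p = p' ∧ q = q' := by
  obtain ⟨c, hf⟩ := isDeparture_step h
  obtain ⟨c', hf'⟩ := isDeparture_step h'
  have l₁ := IsDeparture.isLeast_neg hf (g' := fun t => cnt (swapQueue p q) t - c)
    (fun t => by rw [cnt_swapQueue]; ring) (cnt_sub_cnt_step p q) (cnt_recurrent h)
  have l₂ := IsDeparture.isLeast_neg hf' (g' := fun t => cnt (swapQueue p' q') t - c')
    (fun t => by rw [cnt_swapQueue]; ring) (cnt_sub_cnt_step p' q') (cnt_recurrent h')
  have key : ∀ t, cnt q t = cnt q' t + (c' - c) := by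
    intro t
    obtain ⟨⟨s, hs, a1⟩, a2⟩ := l₁ t
    obtain ⟨⟨s', hs', b1⟩, b2⟩ := l₂ t
    have i1 := a2 ⟨s', hs', rfl⟩
    have i2 := b2 ⟨s, hs, rfl⟩
    simp only [e₁, e₂] at *
    omega
  have hq : q = q' := eq_of_cnt_eq_add _ key
  refine ⟨eq_of_cnt_eq_add 0 fun t => ?_, hq⟩
  have i1 := cnt_swapQueue (p := p) (q := q) t
  have i2 := cnt_swapQueue (p := p') (q := q') t
  rw [e₁, e₂, hq] at i1
  omega

end step

/-! ### The algorithm for the action of a queue -/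

/-- The sites that carry letters at most `k`. -/
def lev {n : ℕ} (u : Word n) (k : ℕ) : Finset (Fin n) := Finset.univ.filter fun i => u i ≤ k

lemma mem_lev {n : ℕ} {u : Word n} {k : ℕ} {i : Fin n} : i ∈ lev u k ↔ u i ≤ k := by simp [lev]

lemma lev_mono {n : ℕ} (u : Word n) : Monotone (lev u) := fun _ _ h _ hi =>
  mem_lev.2 ((mem_lev.1 hi).trans h)

/-- A run of placements at sites of `s` matches the sites of the list with free sites of `s`. -/
lemma foldl_place {n : ℕ} {s : Finset (Fin n)} {sites : Fin n → List (Fin n)}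
    (hs : ∀ i j, j ∈ sites i) (a : Fin n → ℕ) (L : List (Fin n)) (hnd : L.Nodup)
    (hsort : L.Pairwise fun i j => a i ≤ a j) (v₀ : Fin n → Option ℕ)
    (hcard : L.length ≤ (s.filter fun j => v₀ j = none).card) :
    ∃ φ : Fin n → Fin n,
      (∀ i ∈ L, φ i ∈ s ∧ v₀ (φ i) = none ∧
        L.foldl (fun v i => place s (sites i) (a i) v) v₀ (φ i) = some (a i)) ∧
      (∀ i ∈ L, ∀ j ∈ L, φ i = φ j → i = j) ∧
      (∀ j, (∀ i ∈ L, φ i ≠ j) → L.foldl (fun v i => place s (sites i) (a i) v) v₀ j = v₀ j) ∧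
      ∀ i ∈ L, ∃ as bs, sites i = as ++ φ i :: bs ∧
        ∀ j ∈ as, j ∈ s → v₀ j ≠ none ∨ ∃ i' ∈ L, φ i' = j ∧ a i' ≤ a i := by
  classical
  induction L using List.reverseRecOn with
  | nil => exact ⟨id, by simp⟩
  | append_singleton L x ih =>
    rw [List.nodup_append] at hnd
    rw [List.pairwise_append] at hsort
    rw [List.length_append, List.length_singleton] at hcard
    obtain ⟨φ, h1, h2, h3, h4⟩ := ih hnd.1 hsort.1 (by omega)
    have hx : x ∉ L := fun h => hnd.2.2 x h x (by simp) rfl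
    rw [List.foldl_append]
    set v := L.foldl (fun v i => place s (sites i) (a i) v) v₀ with hv
    simp only [List.foldl_cons, List.foldl_nil]
    -- Pigeonhole: the sites of `L` have used up at most `L.length` of the initially free sites of
    -- `s`.
    have hfree : ∃ j ∈ s, v j = none := by
      by_contra! hcon
      have hsub : (s.filter fun j => v₀ j = none) ⊆ L.toFinset.image φ := by
        intro j hj
        rw [Finset.mem_filter] at hj
        by_contra hj'
        refine hcon j hj.1 ?_
        rw [h3 j, hj.2]
        intro i hi e
        exact hj' (Finset.mem_image.2 ⟨i, by simpa using hi, e⟩)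
      have c1 := Finset.card_le_card hsub
      have c2 : (L.toFinset.image φ).card ≤ L.toFinset.card := Finset.card_image_le
      have c3 := L.toFinset_card_le
      omega
    obtain ⟨j₀, hj₀, hj₀'⟩ := hfree
    obtain ⟨y, hy⟩ : ∃ y, (sites x).find? (fun j => decide (j ∈ s ∧ v j = none)) = some y := by
      rw [← Option.isSome_iff_exists, List.find?_isSome]
      exact ⟨j₀, hs x j₀, by simp [hj₀, hj₀']⟩
    have hplace : place s (sites x) (a x) v = Function.update v y (some (a x)) := by
      simp only [place, hy]
    obtain ⟨hy1, as, bs, hy2, hy3⟩ := List.find?_eq_some_iff_append.1 hy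
    simp only [decide_eq_true_eq] at hy1
    simp only [Bool.not_eq_true', decide_eq_false_iff_not, not_and] at hy3
    have hyL : ∀ i ∈ L, φ i ≠ y := by
      rintro i hi rfl
      rw [(h1 i hi).2.2] at hy1
      exact absurd hy1.2 (by simp)
    have hne : ∀ i ∈ L, i ≠ x := by rintro i hi rfl; exact hx hi
    rw [hplace]
    refine ⟨Function.update φ x y, ?_, ?_, ?_, ?_⟩
    · intro i hi
      rw [List.mem_append, List.mem_singleton] at hi
      rcases hi with hi | rfl
      · rw [Function.update_of_ne (hne i hi), Function.update_of_ne (hyL i hi)]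
        exact h1 i hi
      · rw [Function.update_self, Function.update_self]
        exact ⟨hy1.1, by rw [← h3 y hyL]; exact hy1.2, rfl⟩
    · intro i hi j hj e
      rw [List.mem_append, List.mem_singleton] at hi hj
      rcases hi with hi | rfl <;> rcases hj with hj | rfl
      · rw [Function.update_of_ne (hne i hi), Function.update_of_ne (hne j hj)] at e
        exact h2 i hi j hj e
      · rw [Function.update_of_ne (hne i hi), Function.update_self] at e
        exact absurd e (hyL i hi)
      · rw [Function.update_of_ne (hne j hj), Function.update_self] at e
        exact absurd e.symm (hyL j hj)
      · rfl
    · intro j hj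
      have hjy : j ≠ y := by
        have := hj x (by simp)
        rw [Function.update_self] at this
        exact this.symm
      rw [Function.update_of_ne hjy]
      refine h3 j fun i hi => ?_
      have := hj i (by simp [hi])
      rwa [Function.update_of_ne (hne i hi)] at this
    · intro i hi
      rw [List.mem_append, List.mem_singleton] at hi
      rcases hi with hi | rfl
      · rw [Function.update_of_ne (hne i hi)]
        obtain ⟨as', bs', e1, e2⟩ := h4 i hi
        refine ⟨as', bs', e1, fun j hj hjs => (e2 j hj hjs).imp id ?_⟩
        rintro ⟨i', hi', e3, e4⟩
        exact ⟨i', by simp [hi'], by rw [Function.update_of_ne (hne i' hi')]; exact e3, e4⟩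
      · rw [Function.update_self]
        refine ⟨as, bs, hy2, fun j hj hjs => ?_⟩
        by_cases hj0 : v₀ j = none
        · right
          have hvj := hy3 j hj hjs
          have : ∃ i' ∈ L, φ i' = j := by
            by_contra! hcon
            exact hvj (by rw [h3 j hcon]; exact hj0)
          obtain ⟨i', hi', e⟩ := this
          exact ⟨i', by simp [hi'], by rw [Function.update_of_ne (hne i' hi')]; exact e,
            hsort.2.2 i' hi' _ (by simp)⟩
        · exact Or.inl hj0

lemma surj_of_card_le {n : ℕ} {L : List (Fin n)} {s : Finset (Fin n)} {φ : Fin n → Fin n}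
    (hnd : L.Nodup) (hmap : ∀ i ∈ L, φ i ∈ s) (hinj : ∀ i ∈ L, ∀ j ∈ L, φ i = φ j → i = j)
    (hcard : s.card ≤ L.length) : ∀ j ∈ s, ∃ i ∈ L, φ i = j := by
  intro j hj
  have := Finset.surj_on_of_inj_on_of_card_le (s := L.toFinset) (t := s) (fun i _ => φ i)
    (fun i hi => hmap i (by simpa using hi))
    (fun i j hi hj e => hinj i (by simpa using hi) j (by simpa using hj) e)
    (by rwa [List.toFinset_card_of_nodup hnd]) j hj
  obtain ⟨i, hi, e⟩ := this
  exact ⟨i, by simpa using hi, e.symm⟩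

section algorithm

variable {n : ℕ} [NeZero n]

lemma mem_sitesRight (i j : Fin n) : j ∈ sitesRight i := by
  rw [sitesRight, List.mem_map]
  exact ⟨j - i, List.mem_finRange _, by abel⟩

lemma mem_sitesLeft (i j : Fin n) : j ∈ sitesLeft i := by
  rw [sitesLeft, List.mem_map]
  exact ⟨i - j, List.mem_finRange _, by abel⟩

lemma add_eq_site (i k : Fin n) : i + k = site n (i.val + k.val) := by
  apply Fin.ext
  rw [Fin.val_add]
  have h := site_val (n := n) ((i.val : ℤ) + k.val)
  have : (((i.val + k.val) % n : ℕ) : ℤ) = ((i.val : ℤ) + k.val) % n := by push_cast; rfl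
  rw [← this] at h
  exact_mod_cast h.symm

lemma sitesRight_split {i j : Fin n} {as bs : List (Fin n)} (h : sitesRight i = as ++ j :: bs) :
    ∃ d : ℕ, j = site n (i.val + d) ∧ ∀ e < d, site n (i.val + (e : ℕ)) ∈ as := by
  have hlen : (sitesRight i).length = n := by simp [sitesRight]
  have hget : ∀ (k : ℕ) (hk : k < (sitesRight i).length),
      (sitesRight i)[k] = site n (i.val + (k : ℕ)) := by
    intro k hk
    simp only [sitesRight, List.getElem_map, List.getElem_finRange]
    rw [add_eq_site]
    simp
  have hlt : as.length < (sitesRight i).length := by rw [h]; simp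
  refine ⟨as.length, ?_, ?_⟩
  · rw [← hget _ hlt]
    simp [h]
  · intro e he
    rw [← hget e (he.trans hlt)]
    simp only [h]
    rw [List.getElem_append_left he]
    exact List.getElem_mem _

lemma site_add_congr {x y : ℤ} (h : site n x = site n y) (e : ℤ) :
    site n (x + e) = site n (y + e) := by
  rw [site_eq_iff] at h ⊢
  exact Int.ModEq.add_right e h

/-- A matching of `U` with `U'` along the cycle that skips no site of `q` outside of `U'`
characterizes the action of the queue `q`. -/
lemma eq_step_of_matching {q U U' : Finset (Fin n)} (φ : Fin n → Fin n)
    (hmap : ∀ i ∈ U, φ i ∈ U') (hinj : ∀ i ∈ U, ∀ j ∈ U, φ i = φ j → i = j)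
    (hsurj : ∀ j ∈ U', ∃ i ∈ U, φ i = j) (hsub : U' ⊆ q)
    (hblock : ∀ i ∈ U, ∃ d : ℕ, φ i = site n (i.val + d) ∧
      ∀ e < d, site n (i.val + (e : ℕ)) ∈ q → site n (i.val + (e : ℕ)) ∈ U') :
    U' = step q U := by
  have hn := natCast_pos_of_neZero (n := n)
  have : ∀ i, ∃ d : ℕ, i ∈ U → (φ i = site n (i.val + d) ∧
      ∀ e < d, site n (i.val + (e : ℕ)) ∈ q → site n (i.val + (e : ℕ)) ∈ U') := by
    intro i
    by_cases hi : i ∈ U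
    · obtain ⟨d, hd⟩ := hblock i hi
      exact ⟨d, fun _ => hd⟩
    · exact ⟨0, fun h => absurd h hi⟩
  choose d hd using this
  -- The matching lifts to `ℤ` as `x ↦ x + d (site n x)`, which moves points weakly to the right.
  have hΦ : ∀ x : ℤ, site n x ∈ U → site n (x + d (site n x)) = φ (site n x) := by
    intro x hx
    rw [(hd _ hx).1]
    exact site_add_congr (site_coe _).symm _
  have hΦb : ∀ x : ℤ, site n x ∈ U → ∀ y, x ≤ y → y ≤ x + d (site n x) → site n y ∈ q →
      site n y ∈ U' := by
    intro x hx y hxy hy hyq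
    rcases eq_or_lt_of_le hy with rfl | hlt
    · rw [hΦ x hx]; exact hmap _ hx
    · have e : site n ((site n x).val + ((y - x).toNat : ℕ)) = site n y := by
        rw [site_add_congr (site_coe (site n x))]
        congr 1
        omega
      have := (hd _ hx).2 (y - x).toNat (by omega)
      rw [e] at this
      exact this hyq
  have hΦs : ∀ y : ℤ, site n y ∈ U' → ∃ x, site n x ∈ U ∧ x + d (site n x) = y := by
    intro y hy
    obtain ⟨i, hi, e⟩ := hsurj _ hy
    have h1 := (hd i hi).1
    have h2 : site n (y - d i) = i := by
      rw [← site_coe i, sub_eq_add_neg]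
      rw [e] at h1
      rw [site_add_congr h1]
      congr 1
      rw [site_coe]; ring
    exact ⟨y - d i, by rw [h2]; exact hi, by rw [h2]; ring⟩
  have hΦi : ∀ x x' : ℤ, site n x ∈ U → site n x' ∈ U →
      x + d (site n x) = x' + d (site n x') → x = x' := by
    intro x x' hx hx' e
    have h1 := hΦ x hx
    rw [e, hΦ x' hx'] at h1
    rw [hinj _ hx' _ hx h1] at e
    omega
  ext j
  constructor
  · intro hj
    refine mem_step.2 ⟨hsub hj, ?_⟩
    -- Take the last unused service `z` before `j`. All services in `(z, j]` are used, and by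
    -- arrivals in `(z, j]`, since no matched pair may pass over `z`; so `z` is the required
    -- witness.
    by_cases hz : ∃ z < (j.val : ℤ), site n z ∈ q ∧ site n z ∉ U'
    · obtain ⟨z, ⟨hz1, hz2, hz3⟩, hz4⟩ := Int.exists_greatest_of_bdd
        (P := fun z => z < (j.val : ℤ) ∧ site n z ∈ q ∧ site n z ∉ U')
        ⟨j.val, fun z hz => hz.1.le⟩ (by simpa using hz)
      refine ⟨z, hz1, ?_⟩
      rw [cnt_sub_eq_card _ hz1.le, cnt_sub_eq_card _ hz1.le]
      have : ∀ y ∈ (Finset.Ioc z (j.val : ℤ)).filter (fun x => site n x ∈ q),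
          ∃ x ∈ (Finset.Ioc z (j.val : ℤ)).filter (fun x => site n x ∈ U),
            x + d (site n x) = y := by
        intro y hy
        rw [Finset.mem_filter, Finset.mem_Ioc] at hy
        have hyU : site n y ∈ U' := by
          rcases eq_or_lt_of_le hy.1.2 with rfl | hlt
          · rwa [site_coe]
          · by_contra hcon
            have := hz4 y ⟨hlt, hy.2, hcon⟩
            omega
        obtain ⟨x, hx, e⟩ := hΦs y hyU
        refine ⟨x, Finset.mem_filter.2 ⟨Finset.mem_Ioc.2 ⟨?_, by omega⟩, hx⟩, e⟩
        by_contra hcon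
        exact hz3 (hΦb x hx z (by omega) (by omega) hz2)
      exact_mod_cast Finset.card_le_card_of_surjOn (fun x => x + (d (site n x) : ℤ))
        (fun y hy => by
          obtain ⟨x, hx, e⟩ := this y (by simpa using hy)
          exact ⟨x, by simpa using hx, e⟩)
    -- If no service before `j` is unused, then by periodicity none is, so `|q| ≤ |U|` and a full
    -- turn is the witness.
    · push Not at hz
      refine ⟨j.val - n, by omega, ?_⟩
      rw [cnt_sub_period, cnt_sub_period]
      have hqU : q ⊆ U' := by
        intro i hi
        have e : site n ((i.val : ℤ) - n) = i := by
          rw [← site_add_period, sub_add_cancel, site_coe]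
        have := hz (i.val - n) (by have := i.2; omega) (by rwa [e])
        rwa [e] at this
      have : q.card ≤ U.card := (Finset.card_le_card hqU).trans
        (Finset.card_le_card_of_surjOn φ (fun y hy => by
          obtain ⟨x, hx, e⟩ := hsurj y hy
          exact ⟨x, hx, e⟩))
      omega
  · intro hj
    obtain ⟨hjq, s, hs, hle⟩ := mem_step.1 hj
    by_contra hjU
    rw [cnt_sub_eq_card _ hs.le, cnt_sub_eq_card _ hs.le] at hle
    -- If `j` were an unused service, no arrival in `(s, j]` could be matched at `j` or beyond, so
    -- these arrivals would inject into the services of the window other than `j`.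
    have hcard : ((Finset.Ioc s (j.val : ℤ)).filter fun x => site n x ∈ U).card ≤
        (((Finset.Ioc s (j.val : ℤ)).filter fun x => site n x ∈ q).erase j.val).card := by
      refine Finset.card_le_card_of_injOn (fun x => x + (d (site n x) : ℤ)) ?_ ?_
      · intro x hx
        simp only [Finset.coe_filter, Set.mem_ofPred_eq, Finset.mem_Ioc] at hx
        simp only [Finset.coe_erase, Finset.coe_filter, Set.mem_sdiff, Set.mem_ofPred_eq,
          Finset.mem_Ioc, Set.mem_singleton_iff]
        have hlt : x + d (site n x) < (j.val : ℤ) := by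
          by_contra hcon
          have := hΦb x hx.2 j.val hx.1.2 (by omega) (by rwa [site_coe])
          rw [site_coe] at this
          exact hjU this
        refine ⟨⟨⟨by omega, hlt.le⟩, hsub ?_⟩, hlt.ne⟩
        rw [hΦ x hx.2]
        exact hmap _ hx.2
      · intro x hx x' hx' e
        simp only [Finset.coe_filter, Set.mem_ofPred_eq] at hx hx'
        exact hΦi x x' hx.2 hx'.2 e
    rw [Finset.card_erase_of_mem (by
      simp only [Finset.mem_filter, Finset.mem_Ioc, le_refl, and_true, site_coe]
      exact ⟨hs, hjq⟩)] at hcard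
    have hpos : 0 < ((Finset.Ioc s (j.val : ℤ)).filter fun x => site n x ∈ q).card :=
      Finset.card_pos.2 ⟨j.val, by
        simp only [Finset.mem_filter, Finset.mem_Ioc, le_refl, and_true, site_coe]
        exact ⟨hs, hjq⟩⟩
    omega

/-- The letters of `q(u)` when at most `|q|` letters of `u` differ from the largest one. -/
theorem lev_queueAct {q : Finset (Fin n)} {u : Word n} {m : ℕ} (h1 : ∀ i, 1 ≤ u i)
    (hm : ∀ i, u i ≤ m + 1) (hq : (lev u m).card ≤ q.card) :
    (∀ i, 1 ≤ queueAct q u i) ∧ (∀ i, queueAct q u i ≤ m + 2) ∧ lev (queueAct q u) (m + 1) = q ∧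
      ∀ k ≤ m, lev (queueAct q u) k = step q (lev u k) := by
  classical
  set order := (List.finRange n).map (Tuple.sort u) with horder
  have hnd : order.Nodup := (List.nodup_finRange n).map (Tuple.sort u).injective
  have hmem : ∀ i, i ∈ order := fun i => by
    rw [horder, List.mem_map]
    exact ⟨(Tuple.sort u).symm i, List.mem_finRange _, by simp⟩
  have hsort : order.Pairwise fun i j => u i ≤ u j := by
    rw [horder, List.pairwise_map]
    exact (List.pairwise_lt_finRange n).imp fun h => Tuple.monotone_sort u h.le
  have hlen : order.length = n := by simp [horder]
  have hqn : q.card ≤ n := by simpa using Finset.card_le_univ q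
  have hsplit := List.take_append_drop q.card order
  have hnd' := hnd
  have hsort' := hsort
  rw [← hsplit, List.nodup_append] at hnd'
  rw [← hsplit, List.pairwise_append] at hsort'
  have hlen1 : (order.take q.card).length = q.card := by simp [hlen, hqn]
  have hlen2 : (order.drop q.card).length = n - q.card := by simp [hlen]
  -- At most `|q|` letters are at most `m` and they come first in the order, so Phase I meets only
  -- the largest letter.
  have hdrop : ∀ i ∈ order.drop q.card, u i = m + 1 := by
    intro i hi
    by_contra hne
    have him : u i ≤ m := by have := hm i; omega
    have hsub : insert i (order.take q.card).toFinset ⊆ lev u m := by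
      intro j hj
      rw [Finset.mem_insert, List.mem_toFinset] at hj
      rcases hj with rfl | hj
      · exact mem_lev.2 him
      · exact mem_lev.2 ((hsort'.2.2 j hj i hi).trans him)
    have := Finset.card_le_card hsub
    rw [Finset.card_insert_of_notMem (by
      rw [List.mem_toFinset]; exact fun h => hnd'.2.2 i h i hi rfl),
      List.toFinset_card_of_nodup hnd'.1, hlen1] at this
    omega
  obtain ⟨φ₁, a1, a2, a3, -⟩ := foldl_place (s := qᶜ) mem_sitesLeft (fun i => u i + 1)
    (order.drop q.card).reverse (List.nodup_reverse.2 hnd'.2.1)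
    (List.pairwise_iff_forall_sublist.2 fun {x y} hxy => by
      have hx : x ∈ order.drop q.card := by
        rw [← List.mem_reverse]; exact hxy.subset (by simp)
      have hy : y ∈ order.drop q.card := by
        rw [← List.mem_reverse]; exact hxy.subset (by simp)
      rw [hdrop x hx, hdrop y hy]) (fun _ => none) (by
      simp [hlen, Finset.card_compl])
  set v₁ := (order.drop q.card).reverse.foldl
    (fun v i => place qᶜ (sitesLeft i) (u i + 1) v) (fun _ => none) with hv₁
  -- Phase I places `n - |q|` letters, exactly enough to fill the complement of `q`.
  have b1 : ∀ j ∉ q, v₁ j = some (m + 2) := by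
    intro j hj
    obtain ⟨i, hi, rfl⟩ := surj_of_card_le (List.nodup_reverse.2 hnd'.2.1)
      (fun i hi => (a1 i hi).1) a2 (by simp [hlen, Finset.card_compl]) j (by simpa using hj)
    rw [(a1 i hi).2.2, hdrop i (by simpa using hi)]
  have b2 : ∀ j ∈ q, v₁ j = none := by
    intro j hj
    refine a3 j fun i hi e => ?_
    have := (a1 i hi).1
    rw [e] at this
    simp [hj] at this
  have hfilter : (q.filter fun j => v₁ j = none) = q := Finset.filter_true_of_mem b2
  obtain ⟨φ, c1, c2, c3, c4⟩ := foldl_place (s := q) mem_sitesRight u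
    (order.take q.card) hnd'.1 hsort'.1 v₁ (by rw [hfilter, hlen1])
  have hrun : queueRun q u order = (order.take q.card).foldl
    (fun v i => place q (sitesRight i) (u i) v) v₁ := rfl
  rw [← hrun] at c1 c3
  have csurj := surj_of_card_le hnd'.1 (fun i hi => (c1 i hi).1) c2 hlen1.ge
  have w1 : ∀ i ∈ order.take q.card, queueAct q u (φ i) = u i := by
    intro i hi
    rw [queueAct, ← horder, (c1 i hi).2.2]; rfl
  have w2 : ∀ j ∉ q, queueAct q u j = m + 2 := by
    intro j hj
    rw [queueAct, ← horder, c3 j, b1 j hj]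
    · rfl
    · rintro i hi rfl
      exact hj (c1 i hi).1
  have w3 : ∀ j ∈ q, 1 ≤ queueAct q u j ∧ queueAct q u j ≤ m + 1 := by
    intro j hj
    obtain ⟨i, hi, rfl⟩ := csurj j hj
    rw [w1 i hi]
    exact ⟨h1 i, hm i⟩
  refine ⟨fun i => ?_, fun i => ?_, ?_, ?_⟩
  · by_cases hi : i ∈ q
    · exact (w3 i hi).1
    · rw [w2 i hi]; omega
  · by_cases hi : i ∈ q
    · have := (w3 i hi).2; omega
    · rw [w2 i hi]
  · ext j
    rw [mem_lev]
    by_cases hj : j ∈ q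
    · simp [hj, (w3 j hj).2]
    · simp [hj, w2 j hj]
  · intro k hk
    have htake : ∀ i ∈ lev u k, i ∈ order.take q.card := by
      intro i hi
      have := hmem i
      rw [← hsplit, List.mem_append] at this
      refine this.resolve_right fun h => ?_
      have := hdrop i h
      have := mem_lev.1 hi
      omega
    refine eq_step_of_matching φ ?_ ?_ ?_ ?_ ?_
    · intro i hi
      rw [mem_lev, w1 i (htake i hi)]
      exact mem_lev.1 hi
    · exact fun i hi j hj => c2 i (htake i hi) j (htake j hj)
    · intro j hj
      have hjq : j ∈ q := by
        by_contra hcon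
        have := mem_lev.1 hj
        rw [w2 j hcon] at this
        omega
      obtain ⟨i, hi, rfl⟩ := csurj j hjq
      rw [mem_lev, w1 i hi] at hj
      exact ⟨i, mem_lev.2 hj, rfl⟩
    · intro j hj
      by_contra hcon
      have := mem_lev.1 hj
      rw [w2 j hcon] at this
      omega
    · intro i hi
      obtain ⟨as, bs, e1, e2⟩ := c4 i (htake i hi)
      obtain ⟨d, e3, e4⟩ := sitesRight_split e1
      refine ⟨d, e3, fun e he heq => ?_⟩
      rcases e2 _ (e4 e he) heq with h | ⟨i', hi', e5, e6⟩
      · exact absurd (b2 _ heq) h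
      · rw [← e5, mem_lev, w1 i' hi']
        exact e6.trans (mem_lev.1 hi)

end algorithm

open Finset in
/-- The sum of the weights of the sequences of queues of the sizes `K` (the last queue first),
weighted with a function of the chain of the level sets, each of them indexed by its size. -/
def chainSum {n : ℕ} :
    List ℕ → ((ℕ → Finset (Fin n)) → MvPolynomial (Fin n) ℤ) → MvPolynomial (Fin n) ℤ
  | [], φ => φ fun _ => ∅
  | k :: K, φ => ∑ q ∈ powersetCard k univ, (∏ j ∈ q, MvPolynomial.X j) *
      chainSum K fun c => φ (Function.update (fun i => step q (c i)) k q)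

/-- The list `L, L - 1, ..., 1`. -/
def descList : ℕ → List ℕ
  | 0 => []
  | L + 1 => (L + 1) :: descList L

lemma mem_descList {L i : ℕ} : i ∈ descList L ↔ 1 ≤ i ∧ i ≤ L := by
  induction L with
  | zero => simp [descList]; omega
  | succ L ih => rw [descList, List.mem_cons, ih]; omega

lemma descList_pairwise (L : ℕ) : (descList L).Pairwise (· > ·) := by
  induction L with
  | zero => simp [descList]
  | succ L ih =>
    rw [descList, List.pairwise_cons]
    exact ⟨fun i hi => by have := (mem_descList.1 hi).2; omega, ih⟩

section chainSum

variable {n : ℕ}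

lemma chainSum_sum {ι : Type*} (K : List ℕ) (s : Finset ι)
    (φ : ι → (ℕ → Finset (Fin n)) → MvPolynomial (Fin n) ℤ) :
    chainSum K (fun c => ∑ i ∈ s, φ i c) = ∑ i ∈ s, chainSum K (φ i) := by
  induction K generalizing φ with
  | nil => rfl
  | cons k K ih =>
    simp only [chainSum, ih, Finset.mul_sum]
    rw [Finset.sum_comm]

lemma chainSum_mul (K : List ℕ) (a : MvPolynomial (Fin n) ℤ)
    (φ : (ℕ → Finset (Fin n)) → MvPolynomial (Fin n) ℤ) :
    chainSum K (fun c => a * φ c) = a * chainSum K φ := by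
  induction K generalizing φ with
  | nil => rfl
  | cons k K ih =>
    simp only [chainSum, ih, Finset.mul_sum]
    exact Finset.sum_congr rfl fun _ _ => by ring

/-- The properties of the chains of level sets that occur in `chainSum K`. -/
structure IsChainOf (K : List ℕ) (c : ℕ → Finset (Fin n)) : Prop where
  card : ∀ k ∈ K, (c k).card = k
  mono : ∀ k ∈ K, ∀ l ∈ K, k ≤ l → c k ⊆ c l
  empty : ∀ k ∉ K, c k = ∅

lemma IsChainOf.update [NeZero n] {k : ℕ} {K : List ℕ} {c : ℕ → Finset (Fin n)}
    (h : IsChainOf K c) (hK : ∀ l ∈ K, l < k) {q : Finset (Fin n)} (hq : q.card = k) :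
    IsChainOf (k :: K) (Function.update (fun i => step q (c i)) k q) where
  card := by
    intro l hl
    rcases List.mem_cons.1 hl with rfl | hl
    · rw [Function.update_self, hq]
    · rw [Function.update_of_ne (hK l hl).ne, card_step (by rw [h.card l hl, hq]; exact (hK l hl).le),
        h.card l hl]
  mono := by
    intro l hl l' hl' hle
    rcases List.mem_cons.1 hl with e | e <;> rcases List.mem_cons.1 hl' with e' | e'
    · rw [e, e']
    · have := hK l' e'; omega
    · rw [e', Function.update_of_ne (hK l e).ne, Function.update_self]
      exact step_subset _ _
    · rw [Function.update_of_ne (hK l e).ne, Function.update_of_ne (hK l' e').ne]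
      exact step_mono _ (h.mono l e l' e' hle)
  empty := by
    intro l hl
    rw [List.mem_cons, not_or] at hl
    rw [Function.update_of_ne hl.1, h.empty l hl.2, step_empty]

lemma chainSum_congr [NeZero n] {K : List ℕ} (hK : K.Pairwise (· > ·))
    {φ ψ : (ℕ → Finset (Fin n)) → MvPolynomial (Fin n) ℤ}
    (h : ∀ c, IsChainOf K c → φ c = ψ c) : chainSum K φ = chainSum K ψ := by
  induction K generalizing φ ψ with
  | nil => exact h _ ⟨by simp, by simp, by simp⟩
  | cons k K ih =>
    rw [List.pairwise_cons] at hK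
    refine Finset.sum_congr rfl fun q hq => ?_
    rw [ih hK.2 fun c hc => h _ (hc.update hK.1 (Finset.mem_powersetCard.1 hq).2)]

variable [NeZero n]

lemma step_update (q : Finset (Fin n)) (c : ℕ → Finset (Fin n)) (k : ℕ) (p : Finset (Fin n)) :
    (fun i => step q (Function.update c k p i)) =
      Function.update (fun i => step q (c i)) k (step q p) := by
  ext1 i
  by_cases hi : i = k
  · subst hi; simp
  · simp [hi]

/-- The sum over two adjacent queues is invariant under their interchange. -/
lemma sum_interchange {j k : ℕ} (h : j ≤ k) (f : Finset (Fin n) → Finset (Fin n) →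
      MvPolynomial (Fin n) ℤ) :
    ∑ p ∈ Finset.powersetCard j Finset.univ, ∑ q ∈ Finset.powersetCard k Finset.univ,
      (∏ i ∈ p, MvPolynomial.X i) * (∏ i ∈ q, MvPolynomial.X i) *
        f (swapQueue p q) (step q p) =
    ∑ q' ∈ Finset.powersetCard j Finset.univ, ∑ p' ∈ Finset.powersetCard k Finset.univ,
      (∏ i ∈ q', MvPolynomial.X i) * (∏ i ∈ p', MvPolynomial.X i) * f p' q' := by
  rw [← Finset.sum_product', ← Finset.sum_product']
  set S := Finset.powersetCard j (Finset.univ : Finset (Fin n)) ×ˢ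
    Finset.powersetCard k (Finset.univ : Finset (Fin n)) with hS
  have hmem : ∀ x ∈ S, x.1.card = j ∧ x.2.card = k := fun x hx => by
    simpa [hS, Finset.mem_powersetCard] using hx
  have hmaps : ∀ x ∈ S, (step x.2 x.1, swapQueue x.1 x.2) ∈ S := by
    intro x hx
    obtain ⟨h1, h2⟩ := hmem x hx
    have hle : x.1.card ≤ x.2.card := by omega
    simp only [hS, Finset.mem_product, Finset.mem_powersetCard, Finset.subset_univ, true_and]
    exact ⟨by rw [card_step hle, h1], by rw [card_swapQueue hle, h2]⟩
  -- An injective self-map of a finite set is bijective, so no explicit inverse of the interchange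
  -- is needed.
  have hinj : Set.InjOn (fun x : Finset (Fin n) × Finset (Fin n) =>
      (step x.2 x.1, swapQueue x.1 x.2)) S := by
    intro x hx y hy e
    obtain ⟨h1, h2⟩ := hmem x hx
    obtain ⟨h3, h4⟩ := hmem y hy
    simp only [Prod.mk.injEq] at e
    obtain ⟨e1, e2⟩ := swapQueue_injective (by omega) (by omega) e.2 e.1
    exact Prod.ext e1 e2
  refine Finset.sum_nbij (fun x => (step x.2 x.1, swapQueue x.1 x.2)) hmaps hinj
    (Finset.surjOn_of_injOn_of_card_le _ hmaps hinj le_rfl) fun x hx => ?_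
  simp only
  rw [← prod_swapQueue]
  ring

/-- A queue that is at least as large as all the queues below it can be moved to the bottom. -/
theorem chainSum_step {K : List ℕ} {k : ℕ} (hK : ∀ j ∈ K, j ≤ k)
    (φ : (ℕ → Finset (Fin n)) → MvPolynomial (Fin n) ℤ) :
    chainSum K (fun c => ∑ q ∈ Finset.powersetCard k Finset.univ,
      (∏ j ∈ q, MvPolynomial.X j) * φ (fun i => step q (c i))) =
    MvPolynomial.esymm (Fin n) ℤ k * chainSum K φ := by
  induction K generalizing φ with
  | nil => simp only [chainSum, step_empty, MvPolynomial.esymm, Finset.sum_mul]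
  | cons j K ih =>
    -- The unobserved queue of size `k` is moved below the queue of size `j`. The recorded set of
    -- size `j` is `step q p` in either order.
    have key := sum_interchange (hK j (by simp)) fun (p' q' : Finset (Fin n)) =>
      chainSum K fun c => φ (Function.update (fun i => step q' (step p' (c i))) j q')
    have hk : ∀ i ∈ K, i ≤ k := fun i hi => hK i (by simp [hi])
    simp only [chainSum]
    calc _ = ∑ p ∈ Finset.powersetCard j Finset.univ, ∑ q ∈ Finset.powersetCard k Finset.univ,
          (∏ i ∈ p, MvPolynomial.X i) * (∏ i ∈ q, MvPolynomial.X i) * chainSum K fun c =>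
            φ (Function.update (fun i => step (step q p) (step (swapQueue p q) (c i))) j
              (step q p)) := by
          refine Finset.sum_congr rfl fun p hp => ?_
          rw [chainSum_sum, Finset.mul_sum]
          refine Finset.sum_congr rfl fun q hq => ?_
          rw [chainSum_mul, mul_assoc]
          have hle : p.card ≤ q.card := by
            rw [(Finset.mem_powersetCard.1 hp).2, (Finset.mem_powersetCard.1 hq).2]
            exact hK j (by simp)
          simp only [step_update, step_step_swapQueue hle]
      _ = _ := by
          rw [key, Finset.mul_sum]
          refine Finset.sum_congr rfl fun q' _ => ?_
          have := ih hk fun c => φ (Function.update (fun i => step q' (c i)) j q')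
          rw [chainSum_sum] at this
          simp only [chainSum_mul] at this
          rw [mul_left_comm, ← this, Finset.mul_sum]
          exact Finset.sum_congr rfl fun p' _ => by ring

/-- Forgetting some of the level sets multiplies the sum by elementary symmetric polynomials. -/
theorem chainSum_forget (T : Finset ℕ) {K : List ℕ} (hK : K.Pairwise (· > ·))
    (φ : (ℕ → Finset (Fin n)) → MvPolynomial (Fin n) ℤ) :
    chainSum K (fun c => φ fun i => if i ∈ T then ∅ else c i) =
      ((K.filter (· ∈ T)).map (MvPolynomial.esymm (Fin n) ℤ)).prod *
        chainSum (K.filter (· ∉ T)) φ := by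
  induction K generalizing φ with
  | nil => simp [chainSum]
  | cons k K ih =>
    rw [List.pairwise_cons] at hK
    -- When the level set of size `k` is forgotten, only the action of that queue on the smaller
    -- level sets remains, and `chainSum_step` extracts the factor `e_k`.
    by_cases hk : k ∈ T
    · have e : ∀ (q : Finset (Fin n)) (c : ℕ → Finset (Fin n)),
          (fun i => if i ∈ T then ∅ else Function.update (fun i => step q (c i)) k q i) =
            fun i => step q (if i ∈ T then ∅ else c i) := by
        intro q c
        ext1 i
        by_cases hi : i ∈ T
        · simp [hi, step_empty]
        · have : i ≠ k := by rintro rfl; exact hi hk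
          simp [hi, this]
      simp only [chainSum, e]
      rw [List.filter_cons_of_pos (by simpa using hk), List.filter_cons_of_neg (by simpa using hk),
        List.map_cons, List.prod_cons]
      have := ih hK.2 (fun c => ∑ q ∈ Finset.powersetCard k Finset.univ,
        (∏ j ∈ q, MvPolynomial.X j) * φ (fun i => step q (c i)))
      rw [chainSum_step (fun j hj => (hK.1 j (List.mem_of_mem_filter hj)).le), chainSum_sum] at this
      simp only [chainSum_mul] at this
      rw [this]; ring
    · have e : ∀ (q : Finset (Fin n)) (c : ℕ → Finset (Fin n)),
          (fun i => if i ∈ T then ∅ else Function.update (fun i => step q (c i)) k q i) =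
            Function.update (fun i => step q (if i ∈ T then ∅ else c i)) k q := by
        intro q c
        ext1 i
        by_cases hi : i = k
        · subst hi; simp [hk]
        · by_cases hiT : i ∈ T <;> simp [hi, hiT, step_empty]
      simp only [chainSum, e]
      rw [List.filter_cons_of_neg (by simpa using hk), List.filter_cons_of_pos (by simpa using hk)]
      simp only [chainSum, Finset.mul_sum]
      refine Finset.sum_congr rfl fun q _ => ?_
      rw [ih hK.2 fun c => φ (Function.update (fun i => step q (c i)) k q)]
      ring

end chainSum

/-! ### The spectral weight as a sum over chains -/

section translation

variable {n : ℕ} [NeZero n]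

lemma mlqWord_snoc {L : ℕ} (Q : Fin L → Finset (Fin n)) (q : Finset (Fin n)) :
    mlqWord (Fin.snoc Q q : Fin (L + 1) → Finset (Fin n)) = queueAct q (mlqWord Q) := by
  rw [mlqWord, List.ofFn_succ']
  simp [mlqWord]

lemma mlqWeight_snoc {L : ℕ} (Q : Fin L → Finset (Fin n)) (q : Finset (Fin n)) :
    mlqWeight (Fin.snoc Q q : Fin (L + 1) → Finset (Fin n)) =
      (∏ j ∈ q, MvPolynomial.X j) * mlqWeight Q := by
  rw [mlqWeight, Fin.prod_univ_castSucc]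
  simp [mlqWeight, mul_comm]

lemma lev_oneWord : lev (oneWord n) 0 = ∅ := by
  ext i; simp [mem_lev, oneWord]

/-- The level sets of a word, indexed by their sizes `s 1, ..., s L`. -/
def levChain (L : ℕ) (s : ℕ → ℕ) (w : Word n) (k : ℕ) : Finset (Fin n) :=
  ((Finset.Icc 1 L).filter fun i => s i = k).biUnion (lev w)

lemma levChain_apply {L : ℕ} {s : ℕ → ℕ} (hs : ∀ i j, i < j → j ≤ L → s i < s j) (w : Word n)
    {i : ℕ} (h1 : 1 ≤ i) (hL : i ≤ L) : levChain L s w (s i) = lev w i := by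
  have : ((Finset.Icc 1 L).filter fun j => s j = s i) = {i} := by
    ext j
    simp only [Finset.mem_filter, Finset.mem_Icc, Finset.mem_singleton]
    constructor
    · rintro ⟨⟨h2, h3⟩, h4⟩
      rcases lt_trichotomy j i with h | h | h
      · have := hs j i h hL; omega
      · exact h
      · have := hs i j h h3; omega
    · rintro rfl
      exact ⟨⟨h1, hL⟩, rfl⟩
  rw [levChain, this, Finset.singleton_biUnion]

lemma levChain_of_forall_ne {L : ℕ} {s : ℕ → ℕ} (w : Word n) {k : ℕ}
    (h : ∀ i, 1 ≤ i → i ≤ L → s i ≠ k) : levChain L s w k = ∅ := by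
  have : ((Finset.Icc 1 L).filter fun j => s j = k) = ∅ := by
    ext j
    simp only [Finset.mem_filter, Finset.mem_Icc, Finset.notMem_empty, iff_false, not_and]
    exact fun hj => h j hj.1 hj.2
  rw [levChain, this, Finset.biUnion_empty]

/-- These invariants allow `lev_queueAct` to be applied to each new queue: the sizes increase, so
the queue can serve all letters other than the largest possible one. -/
lemma mlqWord_bounds {L : ℕ} {s : ℕ → ℕ} (hs : ∀ i j, i < j → j ≤ L → s i < s j)
    (Q : Fin L → Finset (Fin n)) (hQ : ∀ i, (Q i).card = s (i.val + 1)) :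
    (∀ i, 1 ≤ mlqWord Q i) ∧ (∀ i, mlqWord Q i ≤ L + 1) ∧ (lev (mlqWord Q) L).card ≤ s L := by
  induction L with
  | zero =>
    have : mlqWord Q = oneWord n := by simp [mlqWord]
    rw [this, lev_oneWord]
    simp [oneWord]
  | succ L ih =>
    obtain ⟨Q, q, rfl⟩ : ∃ (Q' : Fin L → Finset (Fin n)) (q : Finset (Fin n)),
        Q = Fin.snoc Q' q := ⟨Fin.init Q, Q (Fin.last L), (Fin.snoc_init_self Q).symm⟩
    obtain ⟨h1, h2, h3⟩ := ih (fun i j hij hj => hs i j hij (by omega)) Q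
      (fun i => by simpa using hQ i.castSucc)
    have hq : q.card = s (L + 1) := by simpa using hQ (Fin.last L)
    rw [mlqWord_snoc]
    obtain ⟨a1, a2, a3, -⟩ := lev_queueAct (q := q) h1 h2
      (by have := hs L (L + 1) (by omega) le_rfl; omega)
    exact ⟨a1, a2, by rw [a3, hq]⟩

lemma levChain_queueAct {L : ℕ} {s : ℕ → ℕ} (hs : ∀ i j, i < j → j ≤ L + 1 → s i < s j)
    (Q : Fin L → Finset (Fin n)) (hQ : ∀ i, (Q i).card = s (i.val + 1)) {q : Finset (Fin n)}
    (hq : q.card = s (L + 1)) :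
    levChain (L + 1) s (queueAct q (mlqWord Q)) =
      Function.update (fun k => step q (levChain L s (mlqWord Q) k)) (s (L + 1)) q := by
  have hs' : ∀ i j, i < j → j ≤ L → s i < s j := fun i j hij hj => hs i j hij (by omega)
  obtain ⟨h1, h2, h3⟩ := mlqWord_bounds hs' Q hQ
  obtain ⟨a1, a2, a3, a4⟩ := lev_queueAct (q := q) h1 h2
    (by have := hs L (L + 1) (by omega) le_rfl; omega)
  ext1 k
  by_cases hk : ∃ i, 1 ≤ i ∧ i ≤ L + 1 ∧ s i = k
  · obtain ⟨i, hi1, hi2, rfl⟩ := hk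
    rw [levChain_apply hs _ hi1 hi2]
    rcases eq_or_lt_of_le hi2 with rfl | hlt
    · rw [Function.update_self, a3]
    · rw [Function.update_of_ne (hs i _ hlt le_rfl).ne, levChain_apply hs' _ hi1 (by omega),
        a4 i (by omega)]
  · push Not at hk
    rw [levChain_of_forall_ne _ hk, Function.update_of_ne (hk _ (by omega) le_rfl).symm,
      levChain_of_forall_ne _ fun i hi hi' => hk i hi (by omega), step_empty]

/-- Splitting off the last queue is the recursion that defines `chainSum`: the queue itself is the
new largest level set, and the older ones are moved by `step`. -/
theorem sum_mlqWeight_eq_chainSum (L : ℕ) {s : ℕ → ℕ} (hs : ∀ i j, i < j → j ≤ L → s i < s j)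
    (φ : (ℕ → Finset (Fin n)) → MvPolynomial (Fin n) ℤ) :
    ∑ Q ∈ Finset.univ.filter (fun Q : Fin L → Finset (Fin n) => ∀ i, (Q i).card = s (i.val + 1)),
      mlqWeight Q * φ (levChain L s (mlqWord Q)) = chainSum ((descList L).map s) φ := by
  induction L generalizing φ with
  | zero =>
    have : ∀ w : Word n, levChain 0 s w = fun _ => ∅ := fun w => by
      ext1 k; exact levChain_of_forall_ne _ (by omega)
    simp [descList, chainSum, this, mlqWeight]
  | succ L ih =>
    have hs' : ∀ i j, i < j → j ≤ L → s i < s j := fun i j hij hj => hs i j hij (by omega)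
    simp only [descList, List.map_cons, chainSum]
    rw [Finset.sum_filter, ← (Fin.snocEquiv fun _ => Finset (Fin n)).sum_comp,
      Fintype.sum_prod_type, Finset.powersetCard_eq_filter, Finset.powerset_univ,
      Finset.sum_filter]
    refine Finset.sum_congr rfl fun q _ => ?_
    have hiff : ∀ Q : Fin L → Finset (Fin n),
        (∀ i : Fin (L + 1), ((Fin.snocEquiv fun _ => Finset (Fin n)) (q, Q) i).card =
          s (i.val + 1)) ↔ q.card = s (L + 1) ∧ ∀ i : Fin L, (Q i).card = s (i.val + 1) := by
      intro Q
      rw [Fin.forall_fin_succ']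
      simp [Fin.snocEquiv, and_comm]
    simp only [hiff]
    split_ifs with hq
    · rw [← ih hs', Finset.sum_filter, Finset.mul_sum]
      refine Finset.sum_congr rfl fun Q _ => ?_
      simp only [hq, true_and]
      split_ifs with hQ
      · have e1 := mlqWeight_snoc Q q
        have e2 := mlqWord_snoc Q q
        have e3 := levChain_queueAct hs Q hQ hq
        simp only [Fin.snocEquiv, Equiv.coe_fn_mk] at *
        rw [e1, e2, e3]
        ring
      · ring
    · simp [hq]

lemma partialSum_typeOf {u : Word n} (h1 : ∀ i, 1 ≤ u i) (k : ℕ) :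
    partialSum (typeOf u) k = (lev u k).card := by
  rw [partialSum]
  have : lev u k = (Finset.Icc 1 k).biUnion fun a => Finset.univ.filter fun i => u i = a := by
    ext i
    simp only [mem_lev, Finset.mem_biUnion, Finset.mem_Icc, Finset.mem_filter, Finset.mem_univ,
      true_and, exists_eq_right']
    exact ⟨fun h => ⟨h1 i, h⟩, fun h => h.2⟩
  rw [this, Finset.card_biUnion]
  · rfl
  · intro a _ b _ hab
    rw [Function.onFun, Finset.disjoint_left]
    intro i hi hi'
    simp only [Finset.mem_filter] at hi hi'
    omega

lemma word_ext_of_lev {u w : Word n} {L : ℕ} (hu : ∀ i, 1 ≤ u i) (hu' : ∀ i, u i ≤ L + 1)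
    (hw : ∀ i, 1 ≤ w i) (hw' : ∀ i, w i ≤ L + 1)
    (h : ∀ k, 1 ≤ k → k ≤ L → lev u k = lev w k) : u = w := by
  have key : ∀ i k, u i ≤ k ↔ w i ≤ k := by
    intro i k
    rcases Nat.lt_or_ge k 1 with hk | hk
    · have := hu i; have := hw i; omega
    · rcases Nat.lt_or_ge L k with hk' | hk'
      · have := hu' i; have := hw' i; omega
      · rw [← mem_lev, h k hk hk', mem_lev]
  ext i
  exact le_antisymm ((key i _).2 le_rfl) ((key i _).1 le_rfl)

open Classical in
/-- The spectral weight of a word whose classes are nonempty, as a sum over chains. -/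
theorem spectralWeight_eq_chainSum {L : ℕ} {u : Word n} (hu : ∀ i, 1 ≤ u i)
    (hu' : ∀ i, u i ≤ L + 1) {s : ℕ → ℕ} (hlev : ∀ i, 1 ≤ i → i ≤ L → (lev u i).card = s i)
    (hs : ∀ i j, i < j → j ≤ L → s i < s j) :
    spectralWeight (L + 1) u = chainSum ((descList L).map s)
      (fun c => if ∀ i, 1 ≤ i → i ≤ L → c (s i) = lev u i then 1 else 0) := by
  rw [← sum_mlqWeight_eq_chainSum L hs, spectralWeight, mlqs, ← Finset.filter_filter,
    Finset.sum_filter]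
  have hset : (Finset.univ.filter fun Q : Fin (L + 1 - 1) → Finset (Fin n) =>
      ∀ i, (Q i).card = partialSum (typeOf u) (i.val + 1)) =
      Finset.univ.filter fun Q : Fin L → Finset (Fin n) => ∀ i, (Q i).card = s (i.val + 1) := by
    ext Q
    simp only [Finset.mem_filter, Finset.mem_univ, true_and]
    refine forall_congr' fun i => ?_
    rw [partialSum_typeOf hu, hlev _ (by omega) (by have := i.2; omega)]
  rw [hset]
  refine Finset.sum_congr rfl fun Q hQ => ?_
  obtain ⟨h1, h2, -⟩ := mlqWord_bounds hs Q (Finset.mem_filter.1 hQ).2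
  have : (∀ i, 1 ≤ i → i ≤ L → levChain L s (mlqWord Q) (s i) = lev u i) ↔ mlqWord Q = u := by
    constructor
    · intro h
      refine word_ext_of_lev h1 h2 hu hu' fun k hk hk' => ?_
      rw [← h k hk hk', levChain_apply hs _ hk hk']
    · rintro rfl i hi hi'
      rw [levChain_apply hs _ hi hi']
  simp only [this]
  split_ifs <;> simp

end translation

lemma ite_congr_prop {α : Type*} {p q : Prop} {_ : Decidable p} {_ : Decidable q} (h : p ↔ q)
    {a b : α} : (if p then a else b) = if q then a else b :=
  if_congr h rfl rfl

/-! ### Level sets of the words of permutations -/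

section permWord

variable {n r : ℕ} {B : Finset (Fin n)} (hB : B.card = r)

lemma permWord_orderEmbOfFin (τ : Equiv.Perm (Fin r)) (j : Fin r) :
    permWord B hB τ (B.orderEmbOfFin hB j) = (τ j).val + 1 :=
  (B.orderEmbOfFin hB).injective.extend_apply _ _ _

lemma permWord_of_notMem (τ : Equiv.Perm (Fin r)) {i : Fin n} (hi : i ∉ B) :
    permWord B hB τ i = r + 1 := by
  refine Function.extend_apply' _ _ _ ?_
  rintro ⟨j, rfl⟩
  exact hi (B.orderEmbOfFin_mem hB j)

lemma exists_orderEmbOfFin_eq {i : Fin n} (hi : i ∈ B) : ∃ j, B.orderEmbOfFin hB j = i := by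
  have : i ∈ Set.range (B.orderEmbOfFin hB) := by rw [Finset.range_orderEmbOfFin]; exact hi
  exact this

lemma one_le_permWord (τ : Equiv.Perm (Fin r)) (i : Fin n) : 1 ≤ permWord B hB τ i := by
  by_cases hi : i ∈ B
  · obtain ⟨j, rfl⟩ := exists_orderEmbOfFin_eq hB hi
    rw [permWord_orderEmbOfFin]; omega
  · rw [permWord_of_notMem hB τ hi]; omega

lemma permWord_le (τ : Equiv.Perm (Fin r)) (i : Fin n) : permWord B hB τ i ≤ r + 1 := by
  by_cases hi : i ∈ B
  · obtain ⟨j, rfl⟩ := exists_orderEmbOfFin_eq hB hi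
    rw [permWord_orderEmbOfFin]; omega
  · rw [permWord_of_notMem hB τ hi]

lemma lev_permWord (τ : Equiv.Perm (Fin r)) {k : ℕ} (hk : k ≤ r) :
    lev (permWord B hB τ) k =
      (Finset.univ.filter fun j => (τ j).val < k).map (B.orderEmbOfFin hB).toEmbedding := by
  ext i
  rw [mem_lev, Finset.mem_map]
  by_cases hi : i ∈ B
  · obtain ⟨j, rfl⟩ := exists_orderEmbOfFin_eq hB hi
    rw [permWord_orderEmbOfFin]
    constructor
    · intro h
      exact ⟨j, by simpa using h, rfl⟩
    · rintro ⟨j', hj', e⟩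
      have := (B.orderEmbOfFin hB).injective e
      subst this
      simp only [Finset.mem_filter] at hj'
      omega
  · rw [permWord_of_notMem hB τ hi]
    constructor
    · intro h; omega
    · rintro ⟨j, -, rfl⟩
      exact absurd (B.orderEmbOfFin_mem hB j) hi

lemma card_lev_permWord (τ : Equiv.Perm (Fin r)) {k : ℕ} (hk : k ≤ r) :
    (lev (permWord B hB τ) k).card = k := by
  rw [lev_permWord hB τ hk, Finset.card_map]
  have : (Finset.univ.filter fun j => (τ j).val < k) =
      (Finset.univ.filter fun j : Fin r => j.val < k).map τ.symm.toEmbedding := by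
    ext j; simp
  rw [this, Finset.card_map, Fin.card_filter_val_lt, min_eq_right hk]

/-- In `Fin r` the transposition `s_i` exchanges the values `i - 1` and `i`, so `{0, ..., k - 1}`
can be moved only when `k = i`. -/
lemma simpleTransposition_lt_iff (i : ℕ) {k : ℕ} (hk : k ≠ i) (x : Fin r) :
    (simpleTransposition r i x).val < k ↔ x.val < k := by
  rw [simpleTransposition]
  split_ifs with h
  · rw [Equiv.swap_apply_def]
    split_ifs with h1 h2
    · subst h1; simp only; omega
    · subst h2; simp only; omega
    · rfl
  · rfl

lemma prod_simpleTransposition_lt_iff (l : List ℕ) {k : ℕ} (hk : k ∉ l) (x : Fin r) :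
    ((l.map (simpleTransposition r)).prod x).val < k ↔ x.val < k := by
  induction l with
  | nil => rfl
  | cons a l ih =>
    rw [List.mem_cons, not_or] at hk
    rw [List.map_cons, List.prod_cons, Equiv.Perm.mul_apply, simpleTransposition_lt_iff a hk.1,
      ih hk.2]

/-- The witness is `k - 1`: factors with larger index fix it, `s_k` sends it to `k`, and the
remaining factors cannot bring it back below `k`. -/
lemma exists_prod_simpleTransposition {l : List ℕ} (hl : l.Pairwise (· < ·)) {k : ℕ}
    (hk : k ∈ l) (h1 : 1 ≤ k) (hr : k < r) :
    ∃ x : Fin r, x.val < k ∧ k ≤ ((l.map (simpleTransposition r)).prod x).val := by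
  induction l with
  | nil => simp at hk
  | cons a l ih =>
    rw [List.pairwise_cons] at hl
    simp only [List.map_cons, List.prod_cons, Equiv.Perm.mul_apply]
    by_cases hka : k = a
    · subst hka
      refine ⟨⟨k - 1, by omega⟩, by simp only; omega, ?_⟩
      have e1 := prod_simpleTransposition_lt_iff (r := r) l (k := k)
        (fun h => (hl.1 k h).ne rfl) ⟨k - 1, by omega⟩
      have e2 := prod_simpleTransposition_lt_iff (r := r) l (k := k - 1)
        (fun h => by have := hl.1 _ h; omega) ⟨k - 1, by omega⟩
      have e3 : (l.map (simpleTransposition r)).prod ⟨k - 1, by omega⟩ = ⟨k - 1, by omega⟩ := by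
        apply Fin.ext
        simp only at e1 e2 ⊢
        omega
      rw [e3, simpleTransposition, dif_pos ⟨h1, hr⟩, Equiv.swap_apply_left]
    · have hk' : k ∈ l := by simpa [hka] using hk
      obtain ⟨x, hx1, hx2⟩ := ih hl.2 hk'
      refine ⟨x, hx1, ?_⟩
      have := simpleTransposition_lt_iff (r := r) a hka
        ((l.map (simpleTransposition r)).prod x)
      omega

lemma lev_sigma_of_notMem {S : Finset ℕ} {k : ℕ} (hk : k ≤ r) (hS : k ∉ S) :
    lev (permWord B hB (sigma r S)) k = lev (permWord B hB (longest r)) k := by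
  rw [lev_permWord hB _ hk, lev_permWord hB _ hk]
  congr 1
  ext j
  rw [Finset.mem_filter, Finset.mem_filter]
  refine and_congr_right fun _ => ?_
  rw [sigma, Equiv.Perm.mul_apply]
  exact prod_simpleTransposition_lt_iff (S.sort (· ≤ ·)) (by simpa using hS) _

/-- Together with `lev_sigma_of_notMem`: the set `S` is recovered as the set of indices where the
level sets of `σ_S` and `w₀` differ. -/
lemma lev_sigma_ne {S : Finset ℕ} {k : ℕ} (h1 : 1 ≤ k) (hk : k < r) (hS : k ∈ S) :
    lev (permWord B hB (sigma r S)) k ≠ lev (permWord B hB (longest r)) k := by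
  obtain ⟨x, hx1, hx2⟩ := exists_prod_simpleTransposition (r := r) (l := S.sort (· ≤ ·))
    (Finset.sortedLT_sort S).pairwise (by simpa using hS) h1 hk
  intro h
  rw [lev_permWord hB _ hk.le, lev_permWord hB _ hk.le] at h
  have h' := Finset.map_injective _ h
  have hmem : (longest r).symm x ∈ Finset.univ.filter fun j => ((longest r) j).val < k := by
    simpa using hx1
  rw [← h', Finset.mem_filter, sigma, Equiv.Perm.mul_apply, Equiv.apply_symm_apply] at hmem
  have := hmem.2
  omega

end permWord

/-- There are only two sets strictly between two sets whose sizes differ by two. -/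
lemma eq_of_ne_of_between {α : Type*} [DecidableEq α] {A X Y Z C : Finset α} {t : ℕ}
    (hA : A.card + 1 = t) (hX : X.card = t) (hY : Y.card = t) (hZ : Z.card = t)
    (hC : C.card = t + 1) (hAX : A ⊆ X) (hAY : A ⊆ Y) (hAZ : A ⊆ Z) (hXC : X ⊆ C) (hYC : Y ⊆ C)
    (hZC : Z ⊆ C) (hYX : Y ≠ X) (hZX : Z ≠ X) : Y = Z := by
  obtain ⟨y, hy⟩ : ∃ y, C \ X = {y} := by
    rw [← Finset.card_eq_one, Finset.card_sdiff_of_subset hXC]; omega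
  -- A competitor of `X` must contain the single element `y` of `C` outside `X`, and then there is
  -- no room for anything beyond `A` and `y`.
  have key : ∀ W : Finset α, W.card = t → A ⊆ W → W ⊆ C → W ≠ X → insert y A = W := by
    intro W hW hAW hWC hne
    have hyX : y ∉ X := by
      have : y ∈ C \ X := by rw [hy]; simp
      exact (Finset.mem_sdiff.1 this).2
    have hyW : y ∈ W := by
      by_contra hcon
      refine hne (Finset.eq_of_subset_of_card_le (fun w hw => ?_) (by omega))
      by_contra hwX
      have : w ∈ C \ X := Finset.mem_sdiff.2 ⟨hWC hw, hwX⟩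
      rw [hy, Finset.mem_singleton] at this
      exact hcon (this ▸ hw)
    refine Finset.eq_of_subset_of_card_le (Finset.insert_subset hyW hAW) ?_
    rw [Finset.card_insert_of_notMem fun h => hyX (hAX h)]
    omega
  rw [← key Y hY hAY hYC hYX, ← key Z hZ hAZ hZC hZX]

/-! ### Merging classes -/

/-- The merges are performed from the largest index down, so a letter above a threshold is still
above it when its turn comes, and is lowered once per threshold below it. -/
lemma foldr_merge_apply {n : ℕ} (u : Word n) {l : List ℕ} (hl : l.Pairwise (· < ·)) (i : Fin n) :
    l.foldr merge u i + (l.filter (· < u i)).length = u i := by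
  induction l with
  | nil => simp
  | cons a l ih =>
    rw [List.pairwise_cons] at hl
    have ih := ih hl.2
    rw [List.foldr_cons, merge]
    by_cases ha : a < u i
    · have hlen : (l.filter (· < u i)).length ≤ u i - a - 1 := by
        rw [← List.toFinset_card_of_nodup ((hl.2.imp fun h => h.ne).filter _), ← Nat.card_Ioo]
        refine Finset.card_le_card fun x hx => ?_
        simp only [List.mem_toFinset, List.mem_filter, decide_eq_true_eq] at hx
        exact Finset.mem_Ioo.2 ⟨hl.1 x hx.1, hx.2⟩
      rw [List.filter_cons_of_pos (by simpa using ha), List.length_cons]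
      split_ifs <;> omega
    · have hnil : l.filter (· < u i) = [] := by
        rw [List.filter_eq_nil_iff]
        intro x hx
        have := hl.1 x hx
        simp only [decide_eq_true_eq]
        omega
      rw [hnil] at ih
      rw [List.filter_cons_of_neg (by simpa using ha), hnil]
      simp only [List.length_nil, add_zero] at ih ⊢
      rw [if_neg (by omega), ih]

/-- The image of the letter `k` under the merging of the classes `t, t + 1` for `t ∈ T`. -/
def mergeLetter (T : Finset ℕ) (k : ℕ) : ℕ := k - (T.filter (· < k)).card

lemma mergeLetter_add (T : Finset ℕ) (k : ℕ) : mergeLetter T k + (T.filter (· < k)).card = k := by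
  have : (T.filter (· < k)).card ≤ k := by
    rw [← Finset.card_range k]
    exact Finset.card_le_card fun x hx => by simpa using (Finset.mem_filter.1 hx).2
  rw [mergeLetter]; omega

lemma mergeSet_apply {n : ℕ} (T : Finset ℕ) (u : Word n) (i : Fin n) :
    mergeSet T u i = mergeLetter T (u i) := by
  have h1 := foldr_merge_apply u (l := T.sort (· ≤ ·)) (Finset.sortedLT_sort T).pairwise i
  have h2 := mergeLetter_add T (u i)
  have h3 : ((T.sort (· ≤ ·)).filter (· < u i)).length = (T.filter (· < u i)).card := by
    rw [← List.toFinset_card_of_nodup ((Finset.sort_nodup T _).filter _)]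
    congr 1
    ext x; simp
  rw [mergeSet]
  omega

lemma mergeLetter_succ (T : Finset ℕ) (k : ℕ) :
    mergeLetter T (k + 1) = mergeLetter T k + if k ∈ T then 0 else 1 := by
  have h1 := mergeLetter_add T k
  have h2 := mergeLetter_add T (k + 1)
  have h3 : T.filter (· < k + 1) = T.filter (· < k) ∪ T.filter (· = k) := by
    ext x; simp only [Finset.mem_filter, Finset.mem_union]; rw [Nat.lt_succ_iff_lt_or_eq]; tauto
  rw [h3, Finset.card_union_of_disjoint (by
    rw [Finset.disjoint_filter]; intro x _ h h'; omega), Finset.filter_eq'] at h2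
  split_ifs at h2 ⊢ <;> simp at h2 <;> omega

lemma mergeLetter_mono (T : Finset ℕ) : Monotone (mergeLetter T) :=
  monotone_nat_of_le_succ fun k => by rw [mergeLetter_succ]; omega

/-- The letters `k` and `k + 1` are not identified when `k ∉ T`, so the cut after `k` survives
merging. -/
lemma mergeLetter_le_iff {T : Finset ℕ} {k : ℕ} (hk : k ∉ T) (x : ℕ) :
    mergeLetter T x ≤ mergeLetter T k ↔ x ≤ k := by
  refine ⟨fun h => ?_, fun h => mergeLetter_mono T h⟩
  by_contra hlt
  have h1 := mergeLetter_mono T (show k + 1 ≤ x by omega)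
  rw [mergeLetter_succ, if_neg hk] at h1
  omega

lemma lev_mergeSet {n : ℕ} {T : Finset ℕ} {k : ℕ} (hk : k ∉ T) (u : Word n) :
    lev (mergeSet T u) (mergeLetter T k) = lev u k := by
  ext i
  rw [mem_lev, mem_lev, mergeSet_apply, mergeLetter_le_iff hk]

lemma map_mergeLetter_descList {T : Finset ℕ} (h0 : 0 ∉ T) (r : ℕ) :
    ((descList r).filter (· ∉ T)).map (mergeLetter T) = descList (mergeLetter T (r + 1) - 1) := by
  induction r with
  | zero => simp [mergeLetter, descList]
  | succ r ih =>
    have hpos : 1 ≤ mergeLetter T (r + 1) := by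
      have := mergeLetter_mono T (show 1 ≤ r + 1 by omega)
      rw [mergeLetter_succ T 0, if_neg h0] at this
      omega
    rw [descList]
    by_cases hr : r + 1 ∈ T
    · rw [List.filter_cons_of_neg (by simpa using hr), ih, mergeLetter_succ T (r + 1), if_pos hr,
        add_zero]
    · rw [List.filter_cons_of_pos (by simpa using hr), List.map_cons, ih,
        mergeLetter_succ T (r + 1), if_neg hr, Nat.add_sub_cancel]
      obtain ⟨m, hm⟩ : ∃ m, mergeLetter T (r + 1) = m + 1 := ⟨_, (Nat.sub_add_cancel hpos).symm⟩
      rw [hm, Nat.add_sub_cancel, descList]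

/-! ### Sums of spectral weights over the fibers of merging -/

section fibers

variable {n r : ℕ} [NeZero n] {B : Finset (Fin n)} (hB : B.card = r) {T : Finset ℕ}

open Classical in
-- The level sets of the merged word are those of the original one with index outside `T`. They keep
-- their sizes, so indexing chains by size makes the two sides match directly.
lemma spectralWeight_mergeSet (hT : T ⊆ Finset.Icc 1 (r - 1)) :
    spectralWeight (r + 1 - T.card) (mergeSet T (permWord B hB (longest r))) =
      chainSum ((descList r).filter (· ∉ T)) (fun c =>
        if ∀ k, 1 ≤ k → k ≤ r → k ∉ T → c k = lev (permWord B hB (longest r)) k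
          then 1 else 0) := by
  set u := permWord B hB (longest r) with hu
  have hT' : ∀ t ∈ T, 1 ≤ t ∧ t ≤ r - 1 := fun t ht => Finset.mem_Icc.1 (hT ht)
  have h0 : 0 ∉ T := fun h => by have := hT' 0 h; omega
  have hcardT : mergeLetter T (r + 1) + T.card = r + 1 := by
    have := mergeLetter_add T (r + 1)
    rwa [Finset.filter_true_of_mem fun t ht => by have := hT' t ht; omega] at this
  have hR1 : mergeLetter T 1 = 1 := by
    rw [mergeLetter_succ T 0, if_neg h0]; simp [mergeLetter]
  set L := mergeLetter T (r + 1) - 1 with hL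
  have hL1 : L + 1 = mergeLetter T (r + 1) := by
    have := mergeLetter_mono T (show 1 ≤ r + 1 by omega)
    omega
  have hlist := map_mergeLetter_descList h0 r
  rw [← hL] at hlist
  have hsurj : ∀ i, 1 ≤ i → i ≤ L → ∃ k, 1 ≤ k ∧ k ≤ r ∧ k ∉ T ∧ mergeLetter T k = i := by
    intro i h1 h2
    have : i ∈ descList L := mem_descList.2 ⟨h1, h2⟩
    rw [← hlist, List.mem_map] at this
    obtain ⟨k, hk, e⟩ := this
    rw [List.mem_filter, mem_descList] at hk
    exact ⟨k, hk.1.1, hk.1.2, by simpa using hk.2, e⟩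
  have hcard : ∀ k, k ≤ r → k ∉ T → (lev (mergeSet T u) (mergeLetter T k)).card = k := by
    intro k hk hkT
    rw [lev_mergeSet hkT, hu, card_lev_permWord hB _ hk]
  have hs : ∀ i j, i < j → j ≤ L → (lev (mergeSet T u) i).card < (lev (mergeSet T u) j).card := by
    intro i j hij hj
    obtain ⟨k, hk1, hk2, hk3, rfl⟩ := hsurj j (by omega) hj
    rw [hcard k hk2 hk3]
    rcases Nat.eq_zero_or_pos i with rfl | hi
    · have : mergeLetter T 0 = 0 := by simp [mergeLetter]
      have := hcard 0 (by omega) h0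
      simp_all
      omega
    · obtain ⟨k', hk1', hk2', hk3', rfl⟩ := hsurj i hi (by omega)
      rw [hcard k' hk2' hk3']
      by_contra hcon
      have := mergeLetter_mono T (show k ≤ k' by omega)
      omega
  rw [show r + 1 - T.card = L + 1 by omega, spectralWeight_eq_chainSum (L := L)
    (s := fun i => (lev (mergeSet T u) i).card) _ _ (fun _ _ _ => rfl) hs]
  · have e : (descList L).map (fun i => (lev (mergeSet T u) i).card) =
        (descList r).filter (· ∉ T) := by
      rw [← hlist, List.map_map]
      conv_rhs => rw [← List.map_id ((descList r).filter (· ∉ T))]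
      refine List.map_congr_left fun k hk => ?_
      rw [List.mem_filter, mem_descList] at hk
      exact hcard k hk.1.2 (by simpa using hk.2)
    rw [e]
    congr 1
    ext1 c
    refine ite_congr_prop ?_
    constructor
    · intro h k hk1 hk2 hk3
      have h1 : 1 ≤ mergeLetter T k := hR1 ▸ mergeLetter_mono T hk1
      have h2 : mergeLetter T k < mergeLetter T (r + 1) := by
        by_contra hcon
        have := (mergeLetter_le_iff hk3 (r + 1)).1 (by omega)
        omega
      have := h (mergeLetter T k) h1 (by omega)
      rwa [hcard k hk2 hk3, lev_mergeSet hk3] at this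
    · intro h i hi1 hi2
      obtain ⟨k, hk1, hk2, hk3, rfl⟩ := hsurj i hi1 hi2
      rw [hcard k hk2 hk3, lev_mergeSet hk3]
      exact h k hk1 hk2 hk3
  · intro i
    rw [mergeSet_apply, ← hR1]
    exact mergeLetter_mono T (one_le_permWord hB _ i)
  · intro i
    rw [mergeSet_apply, hL1]
    exact mergeLetter_mono T (permWord_le hB _ i)

open Classical in
-- By lacunarity the sets of sizes `t - 1` and `t + 1` around each `t ∈ T` are fixed, which leaves
-- two candidates for the set of size `t`: those of `w₀` and of `s_t w₀`. The single contributing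
-- `S` records where the second one occurs.
lemma sum_indicator_sigma (hT : T ⊆ Finset.Icc 1 (r - 1)) (hlac : IsLacunar T)
    {c : ℕ → Finset (Fin n)} (hc : IsChainOf (descList r) c) :
    ∑ S ∈ T.powerset, (if ∀ k, 1 ≤ k → k ≤ r → c k = lev (permWord B hB (sigma r S)) k
        then (1 : MvPolynomial (Fin n) ℤ) else 0) =
      if ∀ k, 1 ≤ k → k ≤ r → k ∉ T → c k = lev (permWord B hB (longest r)) k then 1 else 0 := by
  have hT' : ∀ t ∈ T, 1 ≤ t ∧ t < r := fun t ht => by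
    have := Finset.mem_Icc.1 (hT ht); omega
  split_ifs with h
  · set S₀ := T.filter fun t => c t ≠ lev (permWord B hB (longest r)) t with hS₀
    rw [Finset.sum_eq_single S₀]
    · rw [if_pos]
      intro k hk1 hk2
      by_cases hkS : k ∈ S₀
      · obtain ⟨hkT, hne⟩ := Finset.mem_filter.1 hkS
        have hkr := (hT' k hkT).2
        have hk' : k - 1 ∉ T := fun h' => hlac _ h' (by rwa [Nat.sub_add_cancel hk1])
        have hk'' : k + 1 ∉ T := hlac k hkT
        have hup : c (k + 1) = lev (permWord B hB (longest r)) (k + 1) :=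
          h _ (by omega) (by omega) hk''
        have hdown : lev (permWord B hB (longest r)) (k - 1) ⊆ c k := by
          -- For `k = 1` the lower neighbour is the empty set, which is not among the constrained
          -- members of the chain.
          rcases Nat.eq_or_lt_of_le hk1 with rfl | hlt
          · have : lev (permWord B hB (longest r)) 0 = ∅ := by
              rw [← Finset.card_eq_zero, card_lev_permWord hB _ (by omega)]
            rw [Nat.sub_self, this]
            exact Finset.empty_subset _
          · rw [← h _ (by omega) (by omega) hk']
            exact hc.mono _ (mem_descList.2 (by omega)) _ (mem_descList.2 (by omega)) (by omega)
        refine eq_of_ne_of_between (A := lev (permWord B hB (longest r)) (k - 1))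
          (X := lev (permWord B hB (longest r)) k) (t := k)
          (C := lev (permWord B hB (longest r)) (k + 1)) ?_ ?_ ?_ ?_ ?_ ?_ hdown ?_ ?_ ?_ ?_ hne
          (lev_sigma_ne hB hk1 hkr hkS)
        · rw [card_lev_permWord hB _ (by omega)]; omega
        · exact card_lev_permWord hB _ hk2
        · exact hc.card k (mem_descList.2 ⟨hk1, hk2⟩)
        · exact card_lev_permWord hB _ hk2
        · exact card_lev_permWord hB _ (by omega)
        · exact lev_mono _ (by omega)
        · rw [← lev_sigma_of_notMem hB (S := S₀) (by omega)
            fun h' => hk' (Finset.mem_filter.1 h').1]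
          exact lev_mono _ (by omega)
        · exact lev_mono _ (by omega)
        · rw [← hup]
          exact hc.mono _ (mem_descList.2 (by omega)) _ (mem_descList.2 (by omega)) (by omega)
        · rw [← lev_sigma_of_notMem hB (S := S₀) (by omega)
            fun h' => hk'' (Finset.mem_filter.1 h').1]
          exact lev_mono _ (by omega)
      · rw [lev_sigma_of_notMem hB hk2 hkS]
        by_cases hkT : k ∈ T
        · by_contra hne
          exact hkS (Finset.mem_filter.2 ⟨hkT, hne⟩)
        · exact h k hk1 hk2 hkT
    · intro S hS hne
      rw [if_neg]
      intro h'
      refine hne ?_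
      rw [Finset.mem_powerset] at hS
      ext t
      rw [hS₀, Finset.mem_filter]
      constructor
      · intro ht
        obtain ⟨ht1, ht2⟩ := hT' t (hS ht)
        refine ⟨hS ht, ?_⟩
        rw [h' t ht1 ht2.le]
        exact lev_sigma_ne hB ht1 ht2 ht
      · rintro ⟨htT, hne'⟩
        obtain ⟨ht1, ht2⟩ := hT' t htT
        by_contra hcon
        rw [h' t ht1 ht2.le, lev_sigma_of_notMem hB ht2.le hcon] at hne'
        exact hne' rfl
    · intro hS
      exact absurd (Finset.mem_powerset.2 (Finset.filter_subset _ _)) hS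
  · refine Finset.sum_eq_zero fun S hS => ?_
    rw [if_neg]
    intro h'
    refine h fun k hk1 hk2 hkT => ?_
    rw [h' k hk1 hk2, lev_sigma_of_notMem hB hk2 fun hkS => hkT (Finset.mem_powerset.1 hS hkS)]

/-- The sum of the spectral weights over a fiber of merging. -/
theorem psi_eq_mul_spectralWeight (hT : T ⊆ Finset.Icc 1 (r - 1)) (hlac : IsLacunar T) :
    psi B hB T = (∏ t ∈ T, MvPolynomial.esymm (Fin n) ℤ t) *
      spectralWeight (r + 1 - T.card) (mergeSet T (permWord B hB (longest r))) := by
  classical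
  have hprod : (((descList r).filter (· ∈ T)).map (MvPolynomial.esymm (Fin n) ℤ)).prod =
      ∏ t ∈ T, MvPolynomial.esymm (Fin n) ℤ t := by
    rw [← List.prod_toFinset _ (((descList_pairwise r).imp fun h => h.ne').filter _)]
    refine Finset.prod_congr ?_ fun _ _ => rfl
    ext t
    simp only [List.mem_toFinset, List.mem_filter, mem_descList, decide_eq_true_eq,
      and_iff_right_iff_imp]
    intro ht
    have := Finset.mem_Icc.1 (hT ht)
    omega
  rw [spectralWeight_mergeSet hB hT, ← hprod, ← chainSum_forget T (descList_pairwise r), psi]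
  have h1 : ∀ S ∈ T.powerset, spectralWeight (r + 1) (permWord B hB (sigma r S)) =
      chainSum (descList r) (fun c =>
        if ∀ k, 1 ≤ k → k ≤ r → c k = lev (permWord B hB (sigma r S)) k then 1 else 0) := by
    intro S _
    have := spectralWeight_eq_chainSum (L := r) (u := permWord B hB (sigma r S)) (s := fun i => i)
      (one_le_permWord hB _) (permWord_le hB _) (fun i _ hi => card_lev_permWord hB _ hi)
      (fun i j hij _ => hij)
    rw [List.map_id'] at this
    exact this
  rw [Finset.sum_congr rfl h1, ← chainSum_sum]
  refine chainSum_congr (descList_pairwise r) fun c hc => ?_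
  rw [sum_indicator_sigma hB hT hlac hc]
  refine ite_congr_prop (forall_congr' fun k => ?_)
  refine forall_congr' fun _ => forall_congr' fun _ => forall_congr' fun hk => ?_
  simp only [if_neg hk]

end fibers

/-! ### Complete homogeneous symmetric polynomials -/

section hPoly

open MvPolynomial

variable {σ : Type*} [DecidableEq σ]

/-- The complete homogeneous symmetric polynomial in the variables of a finite set. -/
def hSet (s : Finset σ) (k : ℕ) : MvPolynomial σ ℤ := ∑ m ∈ s.sym k, (m.1.map X).prod

lemma rename_hsymm_subtype [Fintype σ] (s : Finset σ) {p : σ → Prop} [DecidablePred p]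
    (hp : ∀ i, i ∈ s ↔ p i) (k : ℕ) :
    rename Subtype.val (hsymm {i // p i} ℤ k) = hSet s k := by
  have hs : s = (Finset.univ : Finset {i // p i}).map (Function.Embedding.subtype p) := by
    ext i; simp [hp]
  rw [hs, hSet, Finset.sym_map, Finset.sum_map, Finset.sym_univ, hsymm, map_sum]
  refine Finset.sum_congr rfl fun m _ => ?_
  rw [map_multiset_prod, Multiset.map_map]
  simp [Multiset.map_map, Function.comp_def]

lemma hSet_zero (s : Finset σ) : hSet s 0 = 1 := by
  rw [hSet, Finset.sym_zero, Finset.sum_singleton]; rfl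

/-- Multisets are split according to whether they contain `a`; if so, one copy of `a` is removed. -/
lemma hSet_insert {s : Finset σ} {a : σ} (ha : a ∉ s) (k : ℕ) :
    hSet (insert a s) (k + 1) = hSet s (k + 1) + X a * hSet (insert a s) k := by
  classical
  have hsplit : (insert a s).sym (k + 1) =
      s.sym (k + 1) ∪ ((insert a s).sym k).image (Sym.cons a) := by
    ext m
    simp only [Finset.mem_union, Finset.mem_sym_iff, Finset.mem_insert, Finset.mem_image]
    constructor
    · intro h
      by_cases ham : a ∈ m
      · right
        obtain ⟨m', rfl⟩ := Sym.exists_cons_of_mem ham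
        exact ⟨m', fun b hb => h b (Sym.mem_cons_of_mem hb), rfl⟩
      · left
        intro b hb
        exact (h b hb).resolve_left (by rintro rfl; exact ham hb)
    · rintro (h | ⟨m', h, rfl⟩) b hb
      · exact Or.inr (h b hb)
      · rw [Sym.mem_cons] at hb
        exact hb.elim Or.inl (h b)
  rw [hSet, hsplit, Finset.sum_union, Finset.sum_image, hSet, hSet, Finset.mul_sum]
  · congr 1
    refine Finset.sum_congr rfl fun m _ => ?_
    simp [Sym.coe_cons]
  · intro m _ m' _ e
    exact (Sym.cons_inj_right _ _ _).1 e
  · rw [Finset.disjoint_left]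
    intro m hm hm'
    obtain ⟨m', -, rfl⟩ := Finset.mem_image.1 hm'
    exact ha (Finset.mem_sym_iff.1 hm a (Sym.mem_cons_self _ _))

variable {n : ℕ}

lemma hPoly_natCast (b : Fin n) (k : ℕ) : hPoly b (k : ℤ) = hSet (Finset.Iic b) k := by
  rw [hPoly, if_pos (by positivity), Int.toNat_natCast]
  exact rename_hsymm_subtype _ (fun i => Finset.mem_Iic) k

lemma hPoly_of_neg (b : Fin n) {k : ℤ} (hk : k < 0) : hPoly b k = 0 := by
  rw [hPoly, if_neg (by omega)]

lemma hPoly_zero (b : Fin n) : hPoly b 0 = 1 := by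
  have := hPoly_natCast b 0
  rwa [hSet_zero, Nat.cast_zero] at this

lemma hPoly_sub_pred {b b' : Fin n} (h : b'.val + 1 = b.val) (k : ℤ) :
    hPoly b k - hPoly b' k = X b * hPoly b (k - 1) := by
  have hb : Finset.Iic b = insert b (Finset.Iic b') := by
    ext x
    simp only [Finset.mem_Iic, Finset.mem_insert, Fin.le_def, Fin.ext_iff]
    omega
  have hb' : b ∉ Finset.Iic b' := by
    simp only [Finset.mem_Iic, Fin.le_def]; omega
  rcases lt_trichotomy k 0 with hk | rfl | hk
  · rw [hPoly_of_neg _ hk, hPoly_of_neg _ hk, hPoly_of_neg _ (by omega)]; ring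
  · rw [hPoly_zero, hPoly_zero, hPoly_of_neg _ (by omega)]; ring
  · obtain ⟨m, rfl⟩ : ∃ m : ℕ, k = ((m + 1 : ℕ) : ℤ) := ⟨(k - 1).toNat, by omega⟩
    rw [show (((m + 1 : ℕ) : ℤ) - 1) = (m : ℤ) by push_cast; ring, hPoly_natCast, hPoly_natCast,
      hPoly_natCast, hb, hSet_insert hb']
    ring

/-- Telescoping of `hPoly_sub_pred`. This turns a difference of columns into a sum over the sites
between two elements of `B`. -/
lemma hPoly_sub {b b' : Fin n} (h : b' ≤ b) (k : ℤ) :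
    hPoly b k - hPoly b' k = ∑ a ∈ Finset.Ioc b' b, X a * hPoly a (k - 1) := by
  obtain ⟨d, hd⟩ : ∃ d, b.val = b'.val + d := ⟨b.val - b'.val, by rw [Fin.le_def] at h; omega⟩
  induction d generalizing b with
  | zero =>
    have : b = b' := Fin.ext (by simpa using hd)
    subst this; simp
  | succ d ih =>
    have hlt : b'.val + d < n := by have := b.2; omega
    have e : Finset.Ioc b' b = insert b (Finset.Ioc b' ⟨b'.val + d, hlt⟩) := by
      ext x
      simp only [Finset.mem_Ioc, Finset.mem_insert, Fin.le_def, Fin.lt_def, Fin.ext_iff]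
      omega
    rw [e, Finset.sum_insert (by simp only [Finset.mem_Ioc, Fin.le_def, Fin.lt_def]; omega),
      ← ih (b := ⟨b'.val + d, hlt⟩) (by rw [Fin.le_def]; simp) rfl,
      ← hPoly_sub_pred (b' := ⟨b'.val + d, hlt⟩) (by simp only; omega)]
    ring

end hPoly

/-! ### Determinants with columns of complete homogeneous symmetric polynomials -/

section det

open MvPolynomial Matrix

variable {n : ℕ}

/-- The matrix with the entries `h_{i - g_j}(x_1, ..., x_{c_j})`. -/
def colMatrix {r : ℕ} (g : Fin r → ℤ) (c : Fin r → Fin n) :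
    Matrix (Fin r) (Fin r) (MvPolynomial (Fin n) ℤ) :=
  Matrix.of fun i j => hPoly (c j) (i.val - g j)

lemma det_of_row_zero {R : Type*} [CommRing R] {r : ℕ} {A : Matrix (Fin (r + 1)) (Fin (r + 1)) R}
    (h0 : A 0 0 = 1) (h : ∀ j : Fin r, A 0 j.succ = 0) :
    A.det = (A.submatrix Fin.succ Fin.succ).det := by
  rw [Matrix.det_succ_row_zero, Fin.sum_univ_succ]
  simp [h0, h]

lemma det_sum_columns {R : Type*} [CommRing R] {r : ℕ} {α : Type*} [DecidableEq α]
    (A : Fin r → Finset α) (v : Fin r → α → Fin r → R) :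
    (Matrix.of fun i j => ∑ a ∈ A j, v j a i).det =
      ∑ c ∈ Fintype.piFinset A, (Matrix.of fun i j => v j (c j) i).det := by
  rw [← Matrix.det_transpose]
  have e : (Matrix.of fun i j => ∑ a ∈ A j, v j a i)ᵀ = fun j => ∑ a ∈ A j, v j a := by
    ext j i; simp
  have := (Matrix.detRowAlternating (R := R) (n := Fin r)).toMultilinearMap.map_sum_finset
    (fun j a => v j a) A
  rw [e]
  refine this.trans (Finset.sum_congr rfl fun c _ => ?_)
  rw [← Matrix.det_transpose]
  rfl

/-- Subtracting from some columns of `colMatrix g b` the preceding ones. -/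
lemma det_colMatrix_succ {r : ℕ} {g : Fin (r + 1) → ℤ} {b : Fin (r + 1) → Fin n}
    (hb : Monotone b) (st : Fin r → Prop) [DecidablePred st]
    (hg : ∀ j, st j → g j.succ = g j.castSucc) :
    (colMatrix g b).det = (Matrix.of fun (i : Fin (r + 1)) (j : Fin (r + 1)) =>
      (Fin.cases (hPoly (b 0) (i.val - g 0)) (fun j : Fin r => if st j
        then ∑ a ∈ Finset.Ioc (b j.castSucc) (b j.succ), X a * hPoly a (i.val - (g j.succ + 1))
        else hPoly (b j.succ) (i.val - g j.succ)) j : MvPolynomial (Fin n) ℤ)).det := by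
  refine Matrix.det_eq_of_forall_col_eq_smul_add_pred (fun j => if st j then 1 else 0) ?_ ?_
  · intro i; rfl
  · intro i j
    simp only [colMatrix, Matrix.of_apply, Fin.cases_succ]
    split_ifs with h
    · have := hPoly_sub (hb (Fin.castSucc_lt_succ (i := j)).le) (i.val - g j.succ)
      simp only [sub_sub] at this
      rw [← this, hg j h]
      ring
    · ring

/-- The expansion of a determinant whose columns are of two kinds: sums over an interval, and single
ones that extend the preceding column. -/
lemma det_expand {r : ℕ} {g : Fin r → ℤ} {β γ : Fin r → Fin n} (st : Fin r → Prop)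
    [DecidablePred st] (h0 : ∀ j : Fin r, j.val = 0 → st j)
    (h1 : ∀ j j' : Fin r, j'.val + 1 = j.val → ¬ st j → st j' ∧ g j' = g j - 1 ∧ γ j' ≤ γ j) :
    (Matrix.of fun (i j : Fin r) => (if st j
        then ∑ a ∈ Finset.Ioc (β j) (γ j), X a * hPoly a (i.val - g j)
        else hPoly (γ j) (i.val - (g j - 1)) : MvPolynomial (Fin n) ℤ)).det =
      ∑ c ∈ Finset.univ.filter (fun c : Fin r → Fin n => ∀ j, c j ≤ γ j ∧ (st j → β j < c j) ∧
        (¬ st j → ∀ j' : Fin r, j'.val + 1 = j.val → c j' < c j)),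
        (∏ j, X (c j)) * (colMatrix g c).det := by
  classical
  cases r with
  | zero =>
    rw [Matrix.det_isEmpty, Finset.filter_true_of_mem (fun c _ j => j.elim0)]
    simp
  | succ r =>
  set pr : Fin (r + 1) → Fin (r + 1) := fun j => Fin.cases 0 Fin.castSucc j with hpr
  have hpr' : ∀ j, ¬ st j → (pr j).val + 1 = j.val := by
    intro j hj
    induction j using Fin.cases with
    | zero => exact absurd (h0 0 rfl) hj
    | succ j => simp [hpr]
  set A : Fin (r + 1) → Finset (Fin n) := fun j =>
    if st j then Finset.Ioc (β j) (γ j) else {γ j} with hA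
  set A' : (Fin (r + 1) → Fin n) → Fin (r + 1) → Finset (Fin n) := fun c j =>
    if st j then {c j} else Finset.Ioc (c (pr j)) (γ j) with hA'
  -- First stage: expand only the columns that are sums over intervals, with the other columns kept
  -- at `γ j`.
  have s1 : (Matrix.of fun (i j : Fin (r + 1)) => (if st j
        then ∑ a ∈ Finset.Ioc (β j) (γ j), X a * hPoly a (i.val - g j)
        else hPoly (γ j) (i.val - (g j - 1)) : MvPolynomial (Fin n) ℤ)).det =
      ∑ c ∈ Fintype.piFinset A, (Matrix.of fun (i j : Fin (r + 1)) =>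
        (if st j then X (c j) else 1) * (if st j then hPoly (c j) (i.val - g j)
          else hPoly (c j) (i.val - (g j - 1)) : MvPolynomial (Fin n) ℤ)).det := by
    rw [← det_sum_columns A fun j a i => (if st j then X a else 1) *
      (if st j then hPoly a ((i.val : ℤ) - g j) else hPoly a (i.val - (g j - 1)))]
    congr 1
    ext1 i j
    simp only [Matrix.of_apply, hA]
    split_ifs with h
    · rfl
    · simp
  -- Second stage: subtracting the preceding column, now a single `h` at `c (pr j)`, makes each
  -- remaining column a sum over `(c (pr j), γ j]`. This is the source of the condition `c j' < c
  -- j`.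
  have s2 : ∀ c ∈ Fintype.piFinset A, (Matrix.of fun (i j : Fin (r + 1)) =>
        (if st j then X (c j) else 1) * (if st j then hPoly (c j) (i.val - g j)
          else hPoly (c j) (i.val - (g j - 1)) : MvPolynomial (Fin n) ℤ)).det =
      ∑ c' ∈ Fintype.piFinset (A' c), (∏ j, X (c' j)) * (colMatrix g c').det := by
    intro c hc
    rw [Fintype.mem_piFinset] at hc
    have hcst : ∀ j, st j → c j ≤ γ j := fun j hj => by
      have := hc j
      rw [hA] at this
      simp only [hj, if_true, Finset.mem_Ioc] at this
      exact this.2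
    have hcnst : ∀ j, ¬ st j → c j = γ j := fun j hj => by
      have := hc j
      rw [hA] at this
      simpa only [hj, if_false, Finset.mem_singleton] using this
    have t1 := Matrix.det_mul_row (fun j => if st j then (X (c j) : MvPolynomial (Fin n) ℤ) else 1)
      (Matrix.of fun (i j : Fin (r + 1)) => (if st j then hPoly (c j) (i.val - g j)
          else hPoly (c j) (i.val - (g j - 1)) : MvPolynomial (Fin n) ℤ))
    simp only [Matrix.of_apply] at t1
    rw [t1]
    have t2 : (Matrix.of fun (i j : Fin (r + 1)) => (if st j then hPoly (c j) (i.val - g j)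
          else hPoly (c j) (i.val - (g j - 1)) : MvPolynomial (Fin n) ℤ)).det =
        (Matrix.of fun (i j : Fin (r + 1)) => ∑ a ∈ A' c j,
          (if st j then 1 else X a) * hPoly a (i.val - g j)).det := by
      refine Matrix.det_eq_of_forall_col_eq_smul_add_pred
        (fun j => if st j.succ then 0 else 1) ?_ ?_
      · intro i
        simp [h0 0 rfl, hA']
      · intro i j
        simp only [Matrix.of_apply, hA']
        by_cases h : st j.succ
        · simp [h]
        · obtain ⟨e1, e2, e3⟩ := h1 j.succ j.castSucc (by simp) h
          have e4 := hPoly_sub ((hcst _ e1).trans e3) (i.val - (g j.succ - 1))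
          rw [show (i.val : ℤ) - (g j.succ - 1) - 1 = i.val - g j.succ by ring] at e4
          have e5 : pr j.succ = j.castSucc := rfl
          simp only [h, if_false, e1, if_true, e5, hcnst _ h, e2]
          rw [← e4]
          ring
    rw [t2, det_sum_columns (A' c) fun j a i =>
      (if st j then 1 else X a) * hPoly a ((i.val : ℤ) - g j), Finset.mul_sum]
    refine Finset.sum_congr rfl fun c' hc' => ?_
    rw [Fintype.mem_piFinset] at hc'
    have t3 := Matrix.det_mul_row
      (fun j => if st j then (1 : MvPolynomial (Fin n) ℤ) else X (c' j)) (colMatrix g c')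
    simp only [colMatrix, Matrix.of_apply] at t3
    rw [t3, ← mul_assoc, ← Finset.prod_mul_distrib]
    congr 1
    refine Finset.prod_congr rfl fun j _ => ?_
    have := hc' j
    simp only [hA'] at this
    split_ifs at this ⊢ with h
    · rw [Finset.mem_singleton.1 this]; ring
    · ring
  rw [s1, Finset.sum_congr rfl s2, Finset.sum_sigma']
  refine Finset.sum_bij' (fun x _ => x.2)
    (fun c' _ => ⟨fun j => if st j then c' j else γ j, c'⟩) ?_ ?_ ?_ ?_ ?_
  · rintro ⟨c, c'⟩ hx
    simp only [Finset.mem_sigma, Fintype.mem_piFinset] at hx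
    obtain ⟨hc, hc'⟩ := hx
    simp only [Finset.mem_filter, Finset.mem_univ, true_and]
    intro j
    have a1 := hc j
    have a2 := hc' j
    simp only [hA] at a1
    simp only [hA'] at a2
    by_cases h : st j
    · simp only [h, if_true, Finset.mem_singleton, Finset.mem_Ioc] at a1 a2
      rw [a2]
      exact ⟨a1.2, fun _ => a1.1, fun h' => absurd h h'⟩
    · simp only [h, if_false, Finset.mem_Ioc] at a2
      refine ⟨a2.2, fun h' => absurd h' h, fun _ j' hj' => ?_⟩
      have e : pr j = j' := Fin.ext (by have := hpr' j h; omega)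
      have a3 := hc' j'
      simp only [hA', (h1 j j' hj' h).1, if_true, Finset.mem_singleton] at a3
      rw [a3, ← e]
      exact a2.1
  · intro c' hc'
    simp only [Finset.mem_filter, Finset.mem_univ, true_and] at hc'
    simp only [Finset.mem_sigma, Fintype.mem_piFinset]
    refine ⟨fun j => ?_, fun j => ?_⟩
    · simp only [hA]
      obtain ⟨b1, b2, -⟩ := hc' j
      split_ifs with h
      · exact Finset.mem_Ioc.2 ⟨b2 h, b1⟩
      · exact Finset.mem_singleton_self _
    · simp only [hA']
      obtain ⟨b1, -, b3⟩ := hc' j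
      split_ifs with h h'
      · exact Finset.mem_singleton_self _
      · exact Finset.mem_Ioc.2 ⟨b3 h _ (hpr' j h), b1⟩
      · exact absurd (h1 j _ (hpr' j h) h).1 h'
  · rintro ⟨c, c'⟩ hx
    simp only [Finset.mem_sigma, Fintype.mem_piFinset] at hx
    obtain ⟨hc, hc'⟩ := hx
    refine Sigma.ext ?_ HEq.rfl
    ext1 j
    have a1 := hc j
    have a2 := hc' j
    simp only [hA] at a1
    simp only [hA'] at a2
    by_cases h : st j
    · simp only [h, if_true, Finset.mem_singleton] at a2 ⊢
      exact a2
    · simp only [h, if_false, Finset.mem_singleton] at a1 ⊢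
      exact a1.symm
  · intro c' _; rfl
  · rintro ⟨c, c'⟩ _; rfl

end det

/-! ### The largest elements of a set of sites -/

section top

variable {n : ℕ}

/-- The number of elements of `S` that are larger than `x`. -/
def numGt (S : Finset (Fin n)) (x : Fin n) : ℕ := (S.filter (x < ·)).card

/-- The `k` largest elements of `S`. -/
def topSet (S : Finset (Fin n)) (k : ℕ) : Finset (Fin n) := S.filter (numGt S · < k)

lemma numGt_mono {S S' : Finset (Fin n)} (h : S ⊆ S') (x : Fin n) : numGt S x ≤ numGt S' x :=
  Finset.card_le_card (Finset.filter_subset_filter _ h)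

lemma numGt_anti (S : Finset (Fin n)) {x y : Fin n} (h : x ≤ y) : numGt S y ≤ numGt S x :=
  Finset.card_le_card fun z hz => by
    rw [Finset.mem_filter] at hz ⊢
    exact ⟨hz.1, h.trans_lt hz.2⟩

lemma numGt_lt_of_lt {S : Finset (Fin n)} {x y : Fin n} (hy : y ∈ S) (h : x < y) :
    numGt S y < numGt S x := by
  refine Finset.card_lt_card ⟨fun z hz => ?_, fun hsub => ?_⟩
  · rw [Finset.mem_filter] at hz ⊢
    exact ⟨hz.1, h.trans hz.2⟩
  · have := hsub (Finset.mem_filter.2 ⟨hy, h⟩)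
    exact lt_irrefl _ (Finset.mem_filter.1 this).2

lemma numGt_lt_card {S : Finset (Fin n)} {x : Fin n} (hx : x ∈ S) : numGt S x < S.card :=
  Finset.card_lt_card ⟨Finset.filter_subset _ _, fun h => by simpa using h hx⟩

lemma numGt_le_card (S : Finset (Fin n)) (x : Fin n) : numGt S x ≤ S.card :=
  Finset.card_filter_le _ _

lemma topSet_card (S : Finset (Fin n)) : topSet S S.card = S :=
  Finset.filter_true_of_mem fun _ hx => numGt_lt_card hx

lemma topSet_eq_filter {S : Finset (Fin n)} {x : Fin n} {k : ℕ} (h : numGt S x = k) :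
    topSet S k = S.filter (x < ·) := by
  refine Finset.filter_congr fun y hy => ?_
  subst h
  refine ⟨fun hlt => ?_, fun hlt => numGt_lt_of_lt hy hlt⟩
  by_contra hle
  have := numGt_anti S (not_lt.1 hle)
  omega

/-- The dictionary between inequalities for sorted tuples, used by the determinant, and the counts
`numGt`, used by the queues. -/
lemma lt_orderEmbOfFin_iff {r : ℕ} {S : Finset (Fin n)} (hS : S.card = r) (x : Fin n) (j : Fin r) :
    x < S.orderEmbOfFin hS j ↔ r ≤ numGt S x + j.val := by
  have e : numGt S x = (Finset.univ.filter fun j => x < S.orderEmbOfFin hS j).card := by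
    rw [numGt, ← Finset.card_map (S.orderEmbOfFin hS).toEmbedding]
    congr 1
    ext y
    simp only [Finset.mem_filter, Finset.mem_map, Finset.mem_univ, true_and]
    constructor
    · rintro ⟨hy, hxy⟩
      obtain ⟨j, rfl⟩ := exists_orderEmbOfFin_eq hS hy
      exact ⟨j, hxy, rfl⟩
    · rintro ⟨j, hj, rfl⟩
      exact ⟨S.orderEmbOfFin_mem hS j, hj⟩
  constructor
  · intro h
    have : (Finset.Ici j).card ≤ numGt S x := by
      rw [e]
      refine Finset.card_le_card fun i hi => ?_
      rw [Finset.mem_filter]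
      exact ⟨Finset.mem_univ _, h.trans_le
        ((S.orderEmbOfFin hS).monotone (Finset.mem_Ici.1 hi))⟩
    rw [Fin.card_Ici] at this
    omega
  · intro h
    by_contra hle
    have : numGt S x ≤ (Finset.Ioi j).card := by
      rw [e]
      refine Finset.card_le_card fun i hi => ?_
      rw [Finset.mem_filter] at hi
      rw [Finset.mem_Ioi]
      exact (S.orderEmbOfFin hS).lt_iff_lt.1 ((not_lt.1 hle).trans_lt hi.2)
    rw [Fin.card_Ioi] at this
    have := j.2
    omega

lemma numGt_orderEmbOfFin {r : ℕ} {S : Finset (Fin n)} (hS : S.card = r) (j : Fin r) :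
    numGt S (S.orderEmbOfFin hS j) + j.val + 1 = r := by
  have h1 := (lt_orderEmbOfFin_iff hS (S.orderEmbOfFin hS j) j).not.1 (lt_irrefl _)
  by_contra hne
  have hj : j.val + 1 < r := by omega
  have h2 := (lt_orderEmbOfFin_iff hS (S.orderEmbOfFin hS j) ⟨j.val + 1, hj⟩).1
    ((S.orderEmbOfFin hS).lt_iff_lt.2 (by rw [Fin.lt_def]; simp))
  simp only at h2
  omega

lemma exists_numGt_eq {S : Finset (Fin n)} {k : ℕ} (hk : k < S.card) :
    ∃ x ∈ S, numGt S x = k := by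
  have := numGt_orderEmbOfFin (S := S) rfl ⟨S.card - 1 - k, by omega⟩
  exact ⟨_, S.orderEmbOfFin_mem rfl ⟨S.card - 1 - k, by omega⟩, by simp only at this; omega⟩

/-- The permutation `w₀` is decreasing, so its small letters occupy the last sites of `B`. -/
lemma lev_longest {r : ℕ} {B : Finset (Fin n)} (hB : B.card = r) {k : ℕ} (hk : k ≤ r) :
    lev (permWord B hB (longest r)) k = topSet B k := by
  ext x
  rw [lev_permWord hB _ hk, topSet, Finset.mem_map, Finset.mem_filter]
  constructor
  · rintro ⟨j, hj, rfl⟩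
    have h1 := numGt_orderEmbOfFin hB j
    have h2 : ((longest r) j).val < k := by simpa using hj
    rw [longest, Fin.revPerm_apply, Fin.val_rev] at h2
    refine ⟨B.orderEmbOfFin_mem hB j, ?_⟩
    simp only [RelEmbedding.coe_toEmbedding]
    omega
  · rintro ⟨hx, hlt⟩
    obtain ⟨j, rfl⟩ := exists_orderEmbOfFin_eq hB hx
    have h1 := numGt_orderEmbOfFin hB j
    refine ⟨j, ?_, rfl⟩
    rw [Finset.mem_filter, longest, Fin.revPerm_apply, Fin.val_rev]
    exact ⟨Finset.mem_univ _, by omega⟩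

variable [NeZero n]

lemma cnt_coe (S : Finset (Fin n)) (x : Fin n) : cnt S x.val = -(numGt S x : ℤ) := by
  rw [cnt_eq_neg_card S (by omega) (by exact_mod_cast x.2), numGt]
  simp only [Nat.cast_lt, Fin.lt_def]

/-- The sets that a queue `B` moves to its largest elements. -/
theorem step_eq_filter_iff {B U : Finset (Fin n)} {b : Fin n} (hb : b ∈ B)
    (hU : U.card = numGt B b) :
    step B U = B.filter (b < ·) ↔ (∀ x ∈ U, b < x) ∧ ∀ x, numGt U x ≤ numGt B x := by
  have hn := natCast_pos_of_neZero (n := n)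
  have hcard : U.card < B.card := hU ▸ numGt_lt_card hb
  constructor
  · intro h
    obtain ⟨c, hc⟩ := isDeparture_step hcard.le
    have hbY : b ∉ step B U := by rw [h]; simp
    -- No departure occurs at the service site `b`, so the minimum there is attained only at `b`
    -- itself. This gives `c ≥ 0`, the value at `n - 1` gives `c ≤ 0`, and `c = 0` forces all of `U`
    -- to lie beyond `b`.
    have e0 : cnt (step B U) b.val + c = cnt U b.val := by
      obtain ⟨⟨s, hs, e⟩, h1⟩ := hc b.val
      have i1 := h1 ⟨b.val, le_rfl, rfl⟩
      rcases eq_or_lt_of_le hs with rfl | hlt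
      · simp only at *; omega
      · have : ¬ (cnt B b.val - cnt B s ≤ cnt U b.val - cnt U s) := fun hle =>
          hbY (mem_step.2 ⟨hb, s, hlt, hle⟩)
        simp only at *; omega
    have e1 : numGt (step B U) b = numGt B b := by
      rw [h, numGt, Finset.filter_filter]
      simp [numGt]
    have e2 : ∀ S : Finset (Fin n), cnt S ((n : ℤ) - 1) = 0 := by
      intro S
      rw [cnt_eq_neg_card S (by omega) (by omega), Finset.filter_false_of_mem]
      · simp
      · intro j _
        have := j.2
        omega
    have e3 := (hc (n - 1)).2 ⟨n - 1, le_rfl, rfl⟩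
    simp only [e2, sub_self, add_zero, zero_add] at e3
    rw [cnt_coe, cnt_coe, e1] at e0
    have e4 := numGt_le_card U b
    have e5 : numGt U b = U.card := by omega
    have e6 : c = 0 := by omega
    constructor
    · intro x hx
      have : U.filter (b < ·) = U := Finset.eq_of_subset_of_card_le (Finset.filter_subset _ _)
        e5.ge
      rw [← this] at hx
      exact (Finset.mem_filter.1 hx).2
    · intro x
      have e7 := (hc x.val).2 ⟨x.val, le_rfl, rfl⟩
      simp only [cnt_coe, e6, sub_self, add_zero] at e7
      have e8 := numGt_mono (step_subset B U) x
      omega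
  · rintro ⟨h1, h2⟩
    have hk : ∀ x, x ≤ b → numGt U x = U.card := fun x hx => by
      rw [numGt, Finset.filter_true_of_mem fun y hy => hx.trans_lt (h1 y hy)]
    refine Finset.eq_of_subset_of_card_le (fun j hj => ?_) (by rw [card_step hcard.le, hU]; rfl)
    obtain ⟨hjB, s, hs, hle⟩ := mem_step.1 hj
    refine Finset.mem_filter.2 ⟨hjB, ?_⟩
    by_contra hjb
    rw [not_lt] at hjb
    have hs0 : cnt B s = -(numGt B (site n s) : ℤ) + (s / n) * B.card := by
      rw [← cnt_coe, site_val, ← cnt_add_mul, Int.emod_add_mul_ediv]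
    have hs1 : cnt U s = -(numGt U (site n s) : ℤ) + (s / n) * U.card := by
      rw [← cnt_coe, site_val, ← cnt_add_mul, Int.emod_add_mul_ediv]
    rw [cnt_coe, cnt_coe, hs0, hs1, hk j hjb] at hle
    have h3 := h2 (site n s)
    have h4 := numGt_lt_card hjB
    have hp : s / n ≤ 0 := by
      have := Int.ediv_le_ediv hn hs.le
      rwa [Int.ediv_eq_zero_of_lt (a := (j.val : ℤ)) (by positivity) (by exact_mod_cast j.2)] at this
    -- A window with `s ≥ 0` contains the service `j` but no arrival, as all of `U` lies beyond `b`.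
    -- A window reaching into earlier periods fails because each such period has more services than
    -- arrivals.
    rcases eq_or_lt_of_le hp with hp | hp
    · have h5 : site n s < j := by
        have h6 := Int.emod_add_mul_ediv s n
        rw [hp, mul_zero, add_zero, ← site_val] at h6
        rw [Fin.lt_def]
        omega
      have h7 := numGt_lt_of_lt hjB h5
      have h8 := hk _ (h5.le.trans hjb)
      rw [hp, h8] at hle
      omega
    · have h9 : (1 : ℤ) ≤ -(s / n) := by omega
      have h10 : (0 : ℤ) ≤ B.card - U.card := by omega
      nlinarith

/-- The sets `C` such that the queue `B` moves the `k` largest elements of `C` to the `k` largest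
elements of `B` for all `k ≤ m` with `k ∉ T`. -/
def Interlaces (m : ℕ) (T : Finset ℕ) (B C : Finset (Fin n)) : Prop :=
  (∀ x, numGt C x ≤ numGt B x) ∧
    ∀ k, 1 ≤ k → k ≤ m → k ∉ T → ∀ b ∈ B, numGt B b = k → k ≤ numGt C b

lemma Interlaces.step_topSet {m : ℕ} {T : Finset ℕ} {B C : Finset (Fin n)}
    (h : Interlaces m T B C) (hm : m < B.card) {k : ℕ} (h1 : 1 ≤ k) (hk : k ≤ m) (hT : k ∉ T) :
    step B (topSet C k) = topSet B k := by
  obtain ⟨b, hb, e⟩ := exists_numGt_eq (show k < B.card by omega)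
  have eC : numGt C b = k := le_antisymm (e ▸ h.1 b) (h.2 k h1 hk hT b hb e)
  rw [topSet_eq_filter e, topSet_eq_filter eC]
  refine (step_eq_filter_iff hb (e ▸ eC)).2 ⟨fun x hx => (Finset.mem_filter.1 hx).2, fun x => ?_⟩
  exact (numGt_mono (Finset.filter_subset _ _) x).trans (h.1 x)

/-- The set `c k` lies in the part of `c m` beyond the element `b` of `B` with `k` larger elements
in `B`. By domination that part has at most `k` elements, so it equals `c k`: the whole chain is
determined by `c m`. -/
lemma interlaces_of_step {m : ℕ} {T : Finset ℕ} {B : Finset (Fin n)} (hm : m < B.card)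
    (h1m : 1 ≤ m) (hmT : m ∉ T) {c : ℕ → Finset (Fin n)}
    (hc : IsChainOf ((descList m).filter (· ∉ T)) c)
    (h : ∀ k, 1 ≤ k → k ≤ m → k ∉ T → step B (c k) = topSet B k) :
    Interlaces m T B (c m) ∧ ∀ k, 1 ≤ k → k ≤ m → k ∉ T → c k = topSet (c m) k := by
  have hmem : ∀ k, 1 ≤ k → k ≤ m → k ∉ T → k ∈ (descList m).filter (· ∉ T) := by
    intro k h1 h2 h3
    rw [List.mem_filter, mem_descList]
    exact ⟨⟨h1, h2⟩, by simpa using h3⟩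
  have key : ∀ k, 1 ≤ k → k ≤ m → k ∉ T → ∀ b ∈ B, numGt B b = k →
      (∀ x ∈ c k, b < x) ∧ ∀ x, numGt (c k) x ≤ numGt B x := by
    intro k h1 h2 h3 b hb e
    have hk := h k h1 h2 h3
    rw [topSet_eq_filter e] at hk
    exact (step_eq_filter_iff hb (by rw [hc.card k (hmem k h1 h2 h3), e])).1 hk
  have hdom : ∀ x, numGt (c m) x ≤ numGt B x := by
    obtain ⟨b, hb, e⟩ := exists_numGt_eq hm
    exact (key m h1m le_rfl hmT b hb e).2
  have hsub : ∀ k, 1 ≤ k → k ≤ m → k ∉ T → ∀ b ∈ B, numGt B b = k →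
      c k ⊆ (c m).filter (b < ·) := by
    intro k h1 h2 h3 b hb e x hx
    refine Finset.mem_filter.2 ⟨?_, (key k h1 h2 h3 b hb e).1 x hx⟩
    exact hc.mono k (hmem k h1 h2 h3) m (hmem m h1m le_rfl hmT) h2 hx
  have hge : ∀ k, 1 ≤ k → k ≤ m → k ∉ T → ∀ b ∈ B, numGt B b = k → k ≤ numGt (c m) b := by
    intro k h1 h2 h3 b hb e
    have := Finset.card_le_card (hsub k h1 h2 h3 b hb e)
    rwa [hc.card k (hmem k h1 h2 h3)] at this
  refine ⟨⟨hdom, hge⟩, fun k h1 h2 h3 => ?_⟩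
  obtain ⟨b, hb, e⟩ := exists_numGt_eq (show k < B.card by omega)
  have eC : numGt (c m) b = k := le_antisymm (e ▸ hdom b) (hge k h1 h2 h3 b hb e)
  rw [topSet_eq_filter eC]
  refine Finset.eq_of_subset_of_card_le (hsub k h1 h2 h3 b hb e) ?_
  rw [hc.card k (hmem k h1 h2 h3)]
  exact eC.le

/-! ### The recursion for the spectral weights of decreasing words -/

open Classical in
/-- The spectral weight of a word that weakly decreases along `B`, as a sum over chains. -/
def topSum (r : ℕ) (T : Finset ℕ) (B : Finset (Fin n)) : MvPolynomial (Fin n) ℤ :=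
  chainSum ((descList r).filter (· ∉ T))
    (fun c => if ∀ k, 1 ≤ k → k ≤ r → k ∉ T → c k = topSet B k then 1 else 0)

open Classical in
-- At most one `C` contributes, namely the largest member `c m` of the chain, or `∅` when `m = 0`.
lemma sum_indicator_topSet {m : ℕ} {T : Finset ℕ} {B : Finset (Fin n)} (hm : m < B.card)
    (hmT : m ∉ T) {c : ℕ → Finset (Fin n)} (hc : IsChainOf ((descList m).filter (· ∉ T)) c) :
    (if ∀ k, 1 ≤ k → k ≤ m → k ∉ T → step B (c k) = topSet B k
      then (1 : MvPolynomial (Fin n) ℤ) else 0) =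
    ∑ C ∈ (Finset.powersetCard m Finset.univ).filter (Interlaces m T B),
      if ∀ k, 1 ≤ k → k ≤ m → k ∉ T → c k = topSet C k then 1 else 0 := by
  split_ifs with h
  · rcases Nat.eq_zero_or_pos m with rfl | h1m
    · rw [Finset.sum_eq_single ∅]
      · rw [if_pos (by omega)]
      · intro C hC hne
        rw [Finset.mem_filter, Finset.mem_powersetCard, Finset.card_eq_zero] at hC
        exact absurd hC.1.2 hne
      · intro hC
        refine absurd (Finset.mem_filter.2 ⟨by simp, ?_, by omega⟩) hC
        intro x
        simp [numGt]
    · obtain ⟨hI, htop⟩ := interlaces_of_step hm h1m hmT hc h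
      have hcm : (c m).card = m := hc.card m (by
        rw [List.mem_filter, mem_descList]; exact ⟨⟨h1m, le_rfl⟩, by simpa using hmT⟩)
      rw [Finset.sum_eq_single (c m)]
      · rw [if_pos htop]
      · intro C hC hne
        rw [if_neg]
        intro hC'
        rw [Finset.mem_filter, Finset.mem_powersetCard] at hC
        have := hC' m h1m le_rfl hmT
        conv_rhs at this => rw [← hC.1.2]
        rw [topSet_card] at this
        exact hne this.symm
      · intro hC
        exact absurd (Finset.mem_filter.2 ⟨Finset.mem_powersetCard.2
          ⟨Finset.subset_univ _, hcm⟩, hI⟩) hC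
  · refine (Finset.sum_eq_zero fun C hC => ?_).symm
    rw [Finset.mem_filter] at hC
    rw [if_neg]
    intro hC'
    refine h fun k h1 h2 h3 => ?_
    rw [hC' k h1 h2 h3]
    exact hC.2.step_topSet hm h1 h2 h3

open Classical in
theorem topSum_recursion {r m : ℕ} {T : Finset ℕ} {B : Finset (Fin n)} (hB : B.card = r)
    (hm : m < r) (hrT : r ∉ T) (hmT : m ∉ T) (hT : ∀ k, m < k → k < r → k ∈ T) :
    topSum r T B = (∏ b ∈ B, MvPolynomial.X b) *
      ∑ C ∈ (Finset.powersetCard m Finset.univ).filter (Interlaces m T B), topSum m T C := by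
  have hlist : (descList r).filter (· ∉ T) = r :: (descList m).filter (· ∉ T) := by
    obtain ⟨r, rfl⟩ : ∃ r', r = r' + 1 := ⟨r - 1, by omega⟩
    rw [descList, List.filter_cons_of_pos (by simpa using hrT)]
    congr 1
    clear hB hrT
    induction r with
    | zero => rw [show m = 0 by omega]
    | succ r ih =>
      rcases Nat.lt_or_ge m (r + 1) with hlt | hge
      · rw [descList, List.filter_cons_of_neg (by simpa using hT (r + 1) hlt (by omega))]
        exact ih hlt fun k h1 h2 => hT k h1 (by omega)
      · rw [show m = r + 1 by omega]
  have hpw := (descList_pairwise m).filter (fun k => decide (k ∉ T))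
  -- The last queue is itself the level set of size `r`, which is required to be `topSet B r = B`.
  rw [topSum, hlist, chainSum, Finset.sum_eq_single B]
  · congr 1
    simp only [topSum]
    rw [← chainSum_sum]
    refine chainSum_congr hpw fun c hc => ?_
    refine Eq.trans (ite_congr_prop ?_) ((sum_indicator_topSet (by omega) hmT hc).trans
      (Finset.sum_congr rfl fun C _ => ite_congr_prop Iff.rfl))
    refine ⟨fun h k h1 h2 h3 => ?_, fun h k h1 h2 h3 => ?_⟩
    · have := h k h1 (by omega) h3
      rwa [Function.update_of_ne (by omega)] at this
    · rcases eq_or_lt_of_le h2 with rfl | hlt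
      · rw [Function.update_self]
        conv_rhs => rw [← hB]
        rw [topSet_card]
      · rw [Function.update_of_ne hlt.ne]
        refine h k h1 ?_ h3
        by_contra hcon
        exact h3 (hT k (by omega) hlt)
  · intro q hq hne
    have : (fun c : ℕ → Finset (Fin n) => if ∀ k, 1 ≤ k → k ≤ r → k ∉ T →
        Function.update (fun i => step q (c i)) r q k = topSet B k
          then (1 : MvPolynomial (Fin n) ℤ) else 0) = fun c => 0 * 1 := by
      ext1 c
      rw [if_neg, zero_mul]
      intro h
      have := h r (by omega) le_rfl hrT
      rw [Function.update_self] at this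
      conv_rhs at this => rw [← hB]
      rw [topSet_card] at this
      exact hne this
    rw [this, chainSum_mul, zero_mul, mul_zero]
  · intro h
    exact absurd (Finset.mem_powersetCard.2 ⟨Finset.subset_univ _, hB⟩) h

end top

/-! ### The recursion for the determinant -/

section detRecursion

open MvPolynomial

variable {n : ℕ}

/-- The shift of the column `j` of the matrix `hMatrix`. -/
def colShift (r : ℕ) (T : Finset ℕ) (j : ℕ) : ℤ := ((T.filter fun t => r ≤ t + j).card : ℤ)

/-- In zero-based indices the terms `j` cancel, and column `j` is shifted by the number of `t ∈ T`
with `t ≥ r - j`. -/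
lemma hIndex_eq {r : ℕ} (T : Finset ℕ) (i j : Fin r) :
    hIndex T i j = i.val - colShift r T j.val := by
  have : (T.filter fun t => r < t + (j.val + 1)) = T.filter fun t => r ≤ t + j.val :=
    Finset.filter_congr fun t _ => by omega
  rw [hIndex, gam, this, colShift]
  push_cast
  ring

lemma hMatrix_eq_colMatrix {r : ℕ} {B : Finset (Fin n)} (hB : B.card = r) (T : Finset ℕ) :
    hMatrix B hB T = colMatrix (fun j => colShift r T j.val) (B.orderEmbOfFin hB) := by
  ext1 i j
  rw [hMatrix, colMatrix, Matrix.of_apply, Matrix.of_apply, hIndex_eq]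

lemma colShift_nonneg (r : ℕ) (T : Finset ℕ) (j : ℕ) : 0 ≤ colShift r T j := by
  rw [colShift]; positivity

lemma colShift_succ {r : ℕ} (T : Finset ℕ) {j : ℕ} (hj : j < r) :
    colShift r T (j + 1) = colShift r T j + if r - (j + 1) ∈ T then 1 else 0 := by
  have e : (T.filter fun t => r ≤ t + (j + 1)) =
      (T.filter fun t => r ≤ t + j) ∪ T.filter (· = r - (j + 1)) := by
    ext t
    simp only [Finset.mem_filter, Finset.mem_union, ← and_or_left]
    exact and_congr_right fun _ => by omega
  rw [colShift, colShift, e, Finset.card_union_of_disjoint, Finset.filter_eq']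
  · split_ifs <;> simp
  · rw [Finset.disjoint_filter]
    intro t _ h1 h2
    omega

lemma colShift_add (r d : ℕ) (T : Finset ℕ) (j : ℕ) :
    colShift (r + d) T (j + d) = colShift r T j := by
  rw [colShift, colShift]
  congr 2
  exact Finset.filter_congr fun t _ => by omega

lemma colShift_zero {r : ℕ} {T : Finset ℕ} (hT : ∀ t ∈ T, t < r) : colShift r T 0 = 0 := by
  rw [colShift, Finset.filter_false_of_mem fun t ht => by have := hT t ht; omega]
  rfl

lemma colShift_erase {m : ℕ} {T : Finset ℕ} {a : ℕ} (ha : a ∈ T) {j : ℕ} (hj : m ≤ a + j) :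
    colShift m (T.erase a) j = colShift m T j - 1 := by
  have hmem : a ∈ T.filter fun t => m ≤ t + j := Finset.mem_filter.2 ⟨ha, hj⟩
  have := Finset.card_pos.2 ⟨a, hmem⟩
  rw [colShift, colShift, Finset.filter_erase, Finset.card_erase_of_mem hmem]
  omega

/-- The tuples over which the expansion of the determinant runs. -/
def IsBetween {m : ℕ} (T : Finset ℕ) (β γ c : Fin m → Fin n) : Prop :=
  ∀ j, c j ≤ γ j ∧ (m - j.val ∉ T → β j < c j) ∧
    (¬ m - j.val ∉ T → ∀ j' : Fin m, j'.val + 1 = j.val → c j' < c j)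

open Classical in
lemma det_expand_colShift {m : ℕ} {T T' : Finset ℕ} (hT' : ∀ t ≤ m, t ∈ T' ↔ t ∈ T)
    (hmT : m ∉ T) (hlac : IsLacunar T) {β γ : Fin m → Fin n} (hγ : Monotone γ) :
    (Matrix.of fun (i j : Fin m) => (if m - j.val ∉ T
        then ∑ a ∈ Finset.Ioc (β j) (γ j), X a * hPoly a (i.val - colShift m T' j.val)
        else hPoly (γ j) (i.val - (colShift m T' j.val - 1)) : MvPolynomial (Fin n) ℤ)).det =
      ∑ c ∈ Finset.univ.filter (IsBetween T β γ),
        (∏ j, X (c j)) * (colMatrix (fun j => colShift m T' j.val) c).det := by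
  have h := det_expand (g := fun j : Fin m => colShift m T' j.val) (β := β) (γ := γ)
    (fun j => m - j.val ∉ T) ?_ ?_
  · convert h using 2
    ext c
    rw [Finset.mem_filter, Finset.mem_filter]
    rfl
  · intro j hj
    rwa [hj, Nat.sub_zero]
  · intro j j' hjj' hj
    rw [not_not] at hj
    have hlt := j.2
    refine ⟨fun h => hlac _ hj (by rwa [show m - j.val + 1 = m - j'.val by omega]), ?_, ?_⟩
    · have := colShift_succ T' (show j'.val < m from j'.2)
      rw [hjj', if_pos ((hT' _ (by omega)).2 hj)] at this
      simp only [this]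
      ring
    · exact hγ (by rw [Fin.le_def]; omega)

open Classical in
-- Columns with the same shift as their predecessor are replaced by differences, and where the shift
-- jumps nothing is subtracted. Row `0` then becomes `(1, 0, ..., 0)`, and the remaining minor has
-- the form treated by `det_expand`.
theorem det_colMatrix_of_notMem {m : ℕ} {T : Finset ℕ} (hT : ∀ t ∈ T, t < m)
    (hlac : IsLacunar T) {b : Fin (m + 1) → Fin n} (hb : Monotone b) :
    (colMatrix (fun j => colShift (m + 1) T j.val) b).det =
      ∑ c ∈ Finset.univ.filter (IsBetween T (fun j : Fin m => b j.castSucc) fun j => b j.succ),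
        (∏ j, X (c j)) * (colMatrix (fun j => colShift m T j.val) c).det := by
  have hmT : m ∉ T := fun h => lt_irrefl _ (hT m h)
  have hg : ∀ j : Fin m, colShift (m + 1) T j.succ.val = colShift m T j.val := fun j => by
    rw [Fin.val_succ]; exact colShift_add m 1 T j.val
  have hg' : ∀ j : Fin m, colShift (m + 1) T (j.val + 1) =
      colShift (m + 1) T j.val + if m - j.val ∈ T then 1 else 0 := fun j => by
    have := colShift_succ (r := m + 1) T (j := j.val) (by have := j.2; omega)
    rwa [show m + 1 - (j.val + 1) = m - j.val by omega] at this
  rw [← det_expand_colShift (fun _ _ => Iff.rfl) hmT hlac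
      (fun i j h => hb (Fin.succ_le_succ_iff.2 h)),
    det_colMatrix_succ hb (fun j : Fin m => m - j.val ∉ T), det_of_row_zero]
  · congr 1
    ext1 i j
    simp only [Matrix.submatrix_apply, Matrix.of_apply, Fin.cases_succ, hg]
    have e1 : ((i.succ.val : ℕ) : ℤ) - (colShift m T j.val + 1) = i.val - colShift m T j.val := by
      rw [Fin.val_succ]; push_cast; ring
    have e2 : ((i.succ.val : ℕ) : ℤ) - colShift m T j.val = i.val - (colShift m T j.val - 1) := by
      rw [Fin.val_succ]; push_cast; ring
    rw [e1, e2]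
  · simp only [Matrix.of_apply, Fin.cases_zero, Fin.val_zero]
    rw [colShift_zero fun t ht => (hT t ht).trans (Nat.lt_succ_self m)]
    exact hPoly_zero _
  · intro j
    simp only [Matrix.of_apply, Fin.cases_succ, Fin.val_zero]
    split_ifs with h
    · have h1 := colShift_nonneg (m + 1) T j.val
      have h2 := hg' j
      rw [if_pos h] at h2
      refine hPoly_of_neg _ ?_
      rw [Fin.val_succ]; push_cast; omega
    · refine Finset.sum_eq_zero fun a _ => ?_
      have := colShift_nonneg (m + 1) T j.succ.val
      rw [hPoly_of_neg _ (by push_cast; omega), mul_zero]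
  · intro j hj
    have := hg' j
    rw [if_neg hj, add_zero] at this
    exact this

open Classical in
-- Since `m + 1 ∈ T`, the shift already jumps at column `1`. After the column operations the two top
-- rows can be expanded in turn, so the size drops by two; the common extra shift of the remaining
-- columns is absorbed by erasing `m + 1`.
theorem det_colMatrix_of_mem {m : ℕ} {T : Finset ℕ} (hT : ∀ t ∈ T, t < m + 2)
    (hm : m + 1 ∈ T) (hlac : IsLacunar T) {b : Fin (m + 2) → Fin n} (hb : Monotone b) :
    (colMatrix (fun j => colShift (m + 2) T j.val) b).det =
      ∑ c ∈ Finset.univ.filter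
          (IsBetween T (fun j : Fin m => b j.castSucc.succ) fun j => b j.succ.succ),
        (∏ j, X (c j)) * (colMatrix (fun j => colShift m (T.erase (m + 1)) j.val) c).det := by
  have hmT : m ∉ T := fun h => hlac m h hm
  have hg : ∀ j : Fin m, colShift (m + 2) T j.succ.succ.val =
      colShift m (T.erase (m + 1)) j.val + 1 := fun j => by
    rw [colShift_erase hm (by omega), Fin.val_succ, Fin.val_succ, sub_add_cancel]
    exact colShift_add m 2 T j.val
  have hg' : ∀ j : Fin (m + 1), colShift (m + 2) T (j.val + 1) =
      colShift (m + 2) T j.val + if m + 1 - j.val ∈ T then 1 else 0 := fun j => by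
    have := colShift_succ (r := m + 2) T (j := j.val) (by have := j.2; omega)
    rwa [show m + 2 - (j.val + 1) = m + 1 - j.val by omega] at this
  have hg0 : colShift (m + 2) T 0 = 0 := colShift_zero hT
  have hg1 : colShift (m + 2) T 1 = 1 := by
    have := hg' 0
    simpa [hg0, hm] using this
  have hnn := colShift_nonneg m (T.erase (m + 1))
  have hidx : ∀ j : Fin m, m + 1 - j.succ.val = m - j.val := fun j => by
    rw [Fin.val_succ]; omega
  have hsec : ∀ j : Fin m, m - j.val ∈ T → 1 ≤ colShift m (T.erase (m + 1)) j.val := by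
    intro j hj
    rw [colShift]
    have : m - j.val ∈ (T.erase (m + 1)).filter fun t => m ≤ t + j.val := by
      rw [Finset.mem_filter, Finset.mem_erase]
      exact ⟨⟨by omega, hj⟩, by omega⟩
    exact_mod_cast Finset.card_pos.2 ⟨_, this⟩
  rw [← det_expand_colShift (T' := T.erase (m + 1))
      (fun t ht => by rw [Finset.mem_erase]; exact and_iff_right (by omega)) hmT hlac
      (fun i j h => hb (Fin.succ_le_succ_iff.2 (Fin.succ_le_succ_iff.2 h))),
    det_colMatrix_succ hb (fun j : Fin (m + 1) => m + 1 - j.val ∉ T), det_of_row_zero,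
    det_of_row_zero]
  · congr 1
    ext1 i j
    simp only [Matrix.submatrix_apply, Matrix.of_apply, Fin.cases_succ, hg, hidx]
    have e1 : ((i.succ.succ.val : ℕ) : ℤ) - (colShift m (T.erase (m + 1)) j.val + 1 + 1) =
        i.val - colShift m (T.erase (m + 1)) j.val := by
      rw [Fin.val_succ, Fin.val_succ]; push_cast; ring
    have e2 : ((i.succ.succ.val : ℕ) : ℤ) - (colShift m (T.erase (m + 1)) j.val + 1) =
        i.val - (colShift m (T.erase (m + 1)) j.val - 1) := by
      rw [Fin.val_succ, Fin.val_succ]; push_cast; ring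
    rw [e1, e2]
    rfl
  · simp only [Matrix.submatrix_apply, Matrix.of_apply, Fin.cases_succ]
    rw [if_neg (by simpa using hm)]
    simp only [Fin.val_succ, Fin.val_zero, zero_add, hg1]
    exact hPoly_zero _
  · intro j
    simp only [Matrix.submatrix_apply, Matrix.of_apply, Fin.cases_succ, hg, hidx]
    have hv : (((0 : Fin (m + 1)).succ.val : ℕ) : ℤ) = 1 := by simp
    rw [hv]
    split_ifs with h
    · have := hsec j h
      exact hPoly_of_neg _ (by omega)
    · refine Finset.sum_eq_zero fun a _ => ?_
      have := hnn j.val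
      rw [hPoly_of_neg _ (by omega), mul_zero]
  · simp only [Matrix.of_apply, Fin.cases_zero, Fin.val_zero, hg0]
    exact hPoly_zero _
  · intro j
    simp only [Matrix.of_apply, Fin.cases_succ, Fin.val_zero]
    split_ifs with h
    · have h1 := colShift_nonneg (m + 2) T j.val
      have h2 := hg' j
      rw [if_pos h] at h2
      refine hPoly_of_neg _ ?_
      rw [Fin.val_succ]; push_cast; omega
    · refine Finset.sum_eq_zero fun a _ => ?_
      have := colShift_nonneg (m + 2) T j.succ.val
      rw [hPoly_of_neg _ (by push_cast; omega), mul_zero]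
  · intro j hj
    have := hg' j
    rw [if_neg hj, add_zero] at this
    exact this

lemma IsBetween.strictMono {m : ℕ} {T : Finset ℕ} {β γ c : Fin m → Fin n}
    (h : IsBetween T β γ c) (hβγ : ∀ j j' : Fin m, j'.val + 1 = j.val → γ j' ≤ β j) :
    StrictMono c := by
  cases m with
  | zero => exact fun i => i.elim0
  | succ m =>
    refine Fin.strictMono_iff_lt_succ.2 fun j => ?_
    by_cases hj : m + 1 - j.succ.val ∉ T
    · exact (h j.castSucc).1.trans_lt ((hβγ j.succ j.castSucc (by simp)).trans_lt
        ((h j.succ).2.1 hj))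
    · exact (h j.succ).2.2 hj j.castSucc (by simp)

/-- The upper bounds `c j ≤ γ j` express that `B` dominates `C`, and the lower bounds, imposed only
for sizes outside `T`, are the other half of interlacing. The offset `d` is the number of sizes
skipped between `m` and `r`. -/
lemma isBetween_orderEmbOfFin_iff {r m d : ℕ} {T : Finset ℕ} {B C : Finset (Fin n)}
    (hB : B.card = r) (hC : C.card = m) (hr : r = m + d + 1) {β γ : Fin m → Fin n}
    (hβ : ∀ j, β j = B.orderEmbOfFin hB ⟨j.val + d, by have := j.2; omega⟩)
    (hγ : ∀ j, γ j = B.orderEmbOfFin hB ⟨j.val + d + 1, by have := j.2; omega⟩) :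
    IsBetween T β γ (C.orderEmbOfFin hC) ↔ Interlaces m T B C := by
  constructor
  · intro h
    refine ⟨fun x => ?_, fun k h1 hk hkT b hb hbk => ?_⟩
    · by_contra! hlt
      have hle := numGt_le_card C x
      have h1 := (lt_orderEmbOfFin_iff hC x ⟨m - numGt C x, by omega⟩).2 (by simp only; omega)
      have h2 := h1.trans_le (h _).1
      rw [hγ, lt_orderEmbOfFin_iff] at h2
      simp only at h2
      omega
    · obtain ⟨i, rfl⟩ := exists_orderEmbOfFin_eq hB hb
      have h2 := numGt_orderEmbOfFin hB i
      have h3 := (h ⟨m - k, by omega⟩).2.1 (by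
        simp only; rwa [show m - (m - k) = k by omega])
      have h4 : (⟨m - k + d, by omega⟩ : Fin r) = i := Fin.ext (by simp only; omega)
      rw [hβ, lt_orderEmbOfFin_iff] at h3
      simp only [h4] at h3
      omega
  · rintro ⟨h1, h2⟩ j
    have hj := j.2
    refine ⟨?_, fun hjT => ?_, fun _ j' hj' => ?_⟩
    · by_contra! hlt
      have h3 := (lt_orderEmbOfFin_iff hC _ j).1 hlt
      have h4 := h1 (γ j)
      have h5 := numGt_orderEmbOfFin hB ⟨j.val + d + 1, by omega⟩
      rw [← hγ] at h5
      simp only at h5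
      omega
    · rw [lt_orderEmbOfFin_iff]
      have h5 := numGt_orderEmbOfFin hB ⟨j.val + d, by omega⟩
      rw [← hβ] at h5
      simp only at h5
      have := h2 (m - j.val) (by omega) (by omega) hjT (β j)
        (by rw [hβ]; exact B.orderEmbOfFin_mem hB _) (by omega)
      omega
    · exact (C.orderEmbOfFin hC).strictMono (by rw [Fin.lt_def]; omega)

open Classical in
lemma sum_isBetween {M : Type*} [AddCommMonoid M] {r m d : ℕ} {T : Finset ℕ}
    {B : Finset (Fin n)} (hB : B.card = r) (hr : r = m + d + 1) {β γ : Fin m → Fin n}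
    (hβ : ∀ j, β j = B.orderEmbOfFin hB ⟨j.val + d, by have := j.2; omega⟩)
    (hγ : ∀ j, γ j = B.orderEmbOfFin hB ⟨j.val + d + 1, by have := j.2; omega⟩)
    (f : (Fin m → Fin n) → M) (F : Finset (Fin n) → M)
    (hf : ∀ (C : Finset (Fin n)) (hC : C.card = m), f (C.orderEmbOfFin hC) = F C) :
    ∑ c ∈ Finset.univ.filter (IsBetween T β γ), f c =
      ∑ C ∈ (Finset.powersetCard m Finset.univ).filter (Interlaces m T B), F C := by
  have hβγ : ∀ j j' : Fin m, j'.val + 1 = j.val → γ j' ≤ β j := by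
    intro j j' h
    rw [hβ, hγ]
    exact (B.orderEmbOfFin hB).monotone (by rw [Fin.le_def]; simp only; omega)
  symm
  refine Finset.sum_bij (fun C hC => C.orderEmbOfFin
    (Finset.mem_powersetCard.1 (Finset.mem_filter.1 hC).1).2) ?_ ?_ ?_ ?_
  · intro C hC
    have hC' := (Finset.mem_powersetCard.1 (Finset.mem_filter.1 hC).1).2
    exact Finset.mem_filter.2 ⟨Finset.mem_univ _,
      (isBetween_orderEmbOfFin_iff hB hC' hr hβ hγ).2 (Finset.mem_filter.1 hC).2⟩
  · intro C hC C' hC' e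
    have h1 := C.range_orderEmbOfFin (Finset.mem_powersetCard.1 (Finset.mem_filter.1 hC).1).2
    have h2 := C'.range_orderEmbOfFin (Finset.mem_powersetCard.1 (Finset.mem_filter.1 hC').1).2
    rw [e, h2] at h1
    exact_mod_cast h1.symm
  · intro c hc
    have hc' := (Finset.mem_filter.1 hc).2
    have hmono := hc'.strictMono hβγ
    have hcard : (Finset.univ.image c).card = m := by
      rw [Finset.card_image_of_injective _ hmono.injective]; simp
    have e := Finset.orderEmbOfFin_unique hcard (fun x => by simp) hmono
    refine ⟨Finset.univ.image c, Finset.mem_filter.2 ⟨Finset.mem_powersetCard.2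
      ⟨Finset.subset_univ _, hcard⟩, ?_⟩, e.symm⟩
    rw [← isBetween_orderEmbOfFin_iff hB hcard hr hβ hγ, ← e]
    exact hc'
  · intro C hC
    exact (hf C _).symm

lemma prod_orderEmbOfFin {M : Type*} [CommMonoid M] {m : ℕ} {C : Finset (Fin n)}
    (hC : C.card = m) (f : Fin n → M) : ∏ j, f (C.orderEmbOfFin hC j) = ∏ x ∈ C, f x := by
  conv_rhs => rw [← Finset.map_orderEmbOfFin_univ C hC]
  rw [Finset.prod_map]
  rfl

variable [NeZero n]

lemma topSum_congr {m : ℕ} {T T' : Finset ℕ} (h : ∀ t ≤ m, t ∈ T' ↔ t ∈ T)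
    (B : Finset (Fin n)) : topSum m T' B = topSum m T B := by
  have e : (descList m).filter (· ∉ T') = (descList m).filter (· ∉ T) :=
    List.filter_congr fun t ht => by
      have := h t (mem_descList.1 ht).2
      simp [this]
  rw [topSum, topSum, e]
  congr 1
  ext1 c
  refine ite_congr_prop (forall_congr' fun k => forall_congr' fun _ => forall_congr' fun hk => ?_)
  rw [h k hk]

/-- The determinant formula for the spectral weights of weakly decreasing words. -/
theorem topSum_eq_det {r : ℕ} {T : Finset ℕ} (hT : T ⊆ Finset.Icc 1 (r - 1))
    (hlac : IsLacunar T) {B : Finset (Fin n)} (hB : B.card = r) :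
    topSum r T B = (∏ b ∈ B, X b) * (hMatrix B hB T).det := by
  classical
  induction r using Nat.strong_induction_on generalizing T B with
  | _ r ih =>
  have hT' : ∀ t ∈ T, 1 ≤ t ∧ t ≤ r - 1 := fun t ht => Finset.mem_Icc.1 (hT ht)
  rw [hMatrix_eq_colMatrix]
  rcases Nat.eq_zero_or_pos r with rfl | hr
  · rw [Finset.card_eq_zero] at hB
    subst hB
    rw [Matrix.det_isEmpty, topSum, descList, List.filter_nil, chainSum, if_pos (by omega)]
    simp
  obtain ⟨r, rfl⟩ : ∃ r', r = r' + 1 := ⟨r - 1, by omega⟩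
  have hrT : r + 1 ∉ T := fun h => by have := hT' _ h; omega
  -- Now `B` has `r + 1` elements. The next queue has size `r`, unless `r ∈ T`; then lacunarity
  -- makes `r - 1` the next size.
  by_cases hmT : r ∈ T
  · obtain ⟨m, rfl⟩ : ∃ m, r = m + 1 := ⟨r - 1, by have := hT' _ hmT; omega⟩
    have hmT' : m ∉ T := fun h => hlac m h hmT
    rw [topSum_recursion hB (m := m) (by omega) hrT hmT' fun k h1 h2 => by
      rwa [show k = m + 1 by omega]]
    congr 1
    rw [det_colMatrix_of_mem (fun t ht => by have := hT' t ht; omega) hmT hlac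
      (B.orderEmbOfFin hB).monotone]
    refine (sum_isBetween (d := 1) hB (by omega) (fun j => ?_) (fun j => ?_) _ _
      fun C hC => ?_).symm
    · congr 1
    · congr 1
    · rw [prod_orderEmbOfFin hC fun x => (X x : MvPolynomial (Fin n) ℤ), ← hMatrix_eq_colMatrix,
        ← ih m (by omega) ?_ ?_ hC]
      · exact topSum_congr (fun t ht => by
          rw [Finset.mem_erase]; exact and_iff_right (by omega)) C
      · intro t ht
        rw [Finset.mem_erase] at ht
        have h1 := hT' t ht.2
        have h2 : t ≠ m := fun h => hmT' (h ▸ ht.2)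
        exact Finset.mem_Icc.2 ⟨h1.1, by omega⟩
      · exact fun t ht h => hlac t (Finset.mem_of_mem_erase ht) (Finset.mem_of_mem_erase h)
  · have hlt : ∀ t ∈ T, t < r := fun t ht => by
      have h1 := hT' t ht
      have h2 : t ≠ r := fun h => hmT (h ▸ ht)
      omega
    rw [topSum_recursion hB (m := r) (by omega) hrT hmT fun k h1 h2 => by omega]
    congr 1
    rw [det_colMatrix_of_notMem hlt hlac (B.orderEmbOfFin hB).monotone]
    refine (sum_isBetween (d := 0) hB (by omega) (fun j => ?_) (fun j => ?_) _ _
      fun C hC => ?_).symm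
    · congr 1
    · congr 1
    · rw [prod_orderEmbOfFin hC fun x => (X x : MvPolynomial (Fin n) ℤ), ← hMatrix_eq_colMatrix,
        ← ih r (by omega) ?_ hlac hC]
      intro t ht
      have h1 := hT' t ht
      have h2 := hlt t ht
      exact Finset.mem_Icc.2 ⟨h1.1, by omega⟩

theorem spectralWeight_mergeSet_eq_det {r : ℕ} {T : Finset ℕ} (hT : T ⊆ Finset.Icc 1 (r - 1))
    (hlac : IsLacunar T) {B : Finset (Fin n)} (hB : B.card = r) :
    spectralWeight (r + 1 - T.card) (mergeSet T (permWord B hB (longest r))) =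
      (∏ b ∈ B, X b) * (hMatrix B hB T).det := by
  classical
  rw [← topSum_eq_det hT hlac hB, spectralWeight_mergeSet hB hT, topSum]
  congr 1
  ext1 c
  refine ite_congr_prop (forall_congr' fun k => forall_congr' fun _ => forall_congr' fun hk =>
    forall_congr' fun _ => ?_)
  rw [lev_longest hB hk]

end detRecursion

/-! ### Inversion and specialization -/

/-- Möbius inversion on the Boolean lattice: pairing `S` with `insert a S` cancels all terms indexed
by sets without `a`. -/
lemma sum_powerset_neg_one_pow_mul_sum {α R : Type*} [DecidableEq α] [CommRing R] (T : Finset α)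
    (f : Finset α → R) :
    ∑ S ∈ T.powerset, (-1) ^ (T.card - S.card) * ∑ A ∈ S.powerset, f A = f T := by
  induction T using Finset.induction_on generalizing f with
  | empty => simp
  | insert a T ha ih =>
    have hS : ∀ S ∈ T.powerset, S.card ≤ T.card ∧ a ∉ S := fun S hS =>
      ⟨Finset.card_le_card (Finset.mem_powerset.1 hS), fun h => ha (Finset.mem_powerset.1 hS h)⟩
    rw [Finset.sum_powerset_insert ha, ← ih fun A => f (insert a A), ← Finset.sum_add_distrib]
    refine Finset.sum_congr rfl fun S h => ?_
    obtain ⟨h1, h2⟩ := hS S h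
    rw [Finset.sum_powerset_insert h2, Finset.card_insert_of_notMem ha,
      Finset.card_insert_of_notMem h2, Nat.succ_sub h1, pow_succ, Nat.add_sub_add_right]
    ring

section eval

open MvPolynomial

variable {n : ℕ}

lemma eval_one_hPoly (b : Fin n) (k : ℤ) :
    eval (fun _ => (1 : ℤ)) (hPoly b k) = hOnes (b.val + 1) k := by
  rw [hPoly, hOnes]
  split_ifs with h
  · rw [eval_rename, hsymm, map_sum]
    have : ∀ s : Sym {i : Fin n // i ≤ b} k.toNat,
        eval ((fun _ => (1 : ℤ)) ∘ Subtype.val) (s.1.map X).prod = 1 := by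
      intro s
      rw [map_multiset_prod, Multiset.map_map]
      simp
    have hcard : Fintype.card {i : Fin n // i ≤ b} = b.val + 1 := by
      rw [Fintype.card_subtype, ← Fin.card_Iic]
      congr 1
      ext i
      simp
    simp only [this, Finset.sum_const, Finset.card_univ, Sym.card_sym_eq_multichoose, hcard]
    simp
  · simp

lemma eval_one_det_hMatrix {r : ℕ} {B : Finset (Fin n)} (hB : B.card = r) (T : Finset ℕ) :
    eval (fun _ => (1 : ℤ)) (hMatrix B hB T).det = (onesMatrix B hB T).det := by
  rw [RingHom.map_det]
  congr 1
  ext1 i j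
  simp only [RingHom.mapMatrix_apply, Matrix.map_apply, hMatrix, onesMatrix, Matrix.of_apply]
  exact eval_one_hPoly _ _

lemma eval_one_esymm (t : ℕ) :
    eval (fun _ => (1 : ℤ)) (esymm (Fin n) ℤ t) = (n.choose t : ℤ) := by
  rw [esymm, map_sum]
  simp [map_prod]

lemma eval_one_spectralWeight [NeZero n] (ℓ : ℕ) (u : Word n) :
    eval (fun _ => (1 : ℤ)) (spectralWeight ℓ u) = ((mlqs ℓ u).card : ℤ) := by
  rw [spectralWeight, map_sum]
  simp [mlqWeight, map_prod]

end eval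

end MLQ

end

/-! ### Assembly: product formula, determinant, inversion and evaluation at ones -/

theorem mainTheorem6 (n r : ℕ) [NeZero n] (B : Finset (Fin n)) (hB : B.card = r)
    (T : Finset ℕ) (hT : T ⊆ Finset.Icc 1 (r - 1)) (hlac : MLQ.IsLacunar T) :
    MLQ.psi B hB T =
        (∏ t ∈ T, MvPolynomial.esymm (Fin n) ℤ t) *
          MLQ.spectralWeight (r + 1 - T.card)
            (MLQ.mergeSet T (MLQ.permWord B hB (MLQ.longest r))) ∧
    MLQ.psi B hB T =
        (∏ b ∈ B, MvPolynomial.X b) * (∏ t ∈ T, MvPolynomial.esymm (Fin n) ℤ t) *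
          (MLQ.hMatrix B hB T).det ∧
    MLQ.spectralWeight (r + 1) (MLQ.permWord B hB (MLQ.sigma r T)) =
        ∑ S ∈ T.powerset, (-1) ^ (T.card - S.card) * MLQ.psi B hB S ∧
    MvPolynomial.eval (fun _ => (1 : ℤ))
          (MLQ.spectralWeight (r + 1) (MLQ.permWord B hB (MLQ.sigma r T))) =
        ((MLQ.mlqs (r + 1) (MLQ.permWord B hB (MLQ.sigma r T))).card : ℤ) ∧
    MvPolynomial.eval (fun _ => (1 : ℤ))
          (MLQ.spectralWeight (r + 1) (MLQ.permWord B hB (MLQ.sigma r T))) =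
        ∑ S ∈ T.powerset, (-1) ^ (T.card - S.card) *
          ((∏ t ∈ S, (n.choose t : ℤ)) * (MLQ.onesMatrix B hB S).det) := by
  -- Stated for all subsets, which are again lacunar, because the inversion formula uses the
  -- determinant for every `S ⊆ T`.
  have hpsi : ∀ S ⊆ T, MLQ.psi B hB S =
      (∏ b ∈ B, MvPolynomial.X b) * (∏ t ∈ S, MvPolynomial.esymm (Fin n) ℤ t) *
        (MLQ.hMatrix B hB S).det := by
    intro S hS
    have hS' : MLQ.IsLacunar S := fun i hi h => hlac i (hS hi) (hS h)
    rw [MLQ.psi_eq_mul_spectralWeight hB (hS.trans hT) hS',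
      MLQ.spectralWeight_mergeSet_eq_det (hS.trans hT) hS' hB]
    ring
  have hinv : MLQ.spectralWeight (r + 1) (MLQ.permWord B hB (MLQ.sigma r T)) =
      ∑ S ∈ T.powerset, (-1) ^ (T.card - S.card) * MLQ.psi B hB S :=
    (MLQ.sum_powerset_neg_one_pow_mul_sum T fun S =>
      MLQ.spectralWeight (r + 1) (MLQ.permWord B hB (MLQ.sigma r S))).symm
  refine ⟨MLQ.psi_eq_mul_spectralWeight hB hT hlac, hpsi T subset_rfl, hinv,
    MLQ.eval_one_spectralWeight _ _, ?_⟩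
  rw [hinv, map_sum]
  refine Finset.sum_congr rfl fun S hS => ?_
  rw [hpsi S (Finset.mem_powerset.1 hS)]
  simp only [map_mul, map_pow, map_neg, map_one, map_prod, MvPolynomial.eval_X,
    Finset.prod_const_one, one_mul, MLQ.eval_one_esymm, MLQ.eval_one_det_hMatrix]
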